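/- Fix an uncountable regular cardinal $\kappa$ and an ordered field $\mathbf K$. For a linearly ordered abelian group $\mathfrak M$ (written multiplicatively, with strict order $\prec$), let $\mathbf K[\![\mathfrak M]\!]$ be the field of functions $s:\mathfrak M\to\mathbf K$ whose support $\operatorname{supp} s$ is well-ordered for $\succ$ and of size $<\kappa$ (if $\kappa>|\mathfrak M|$, the size condition is void). It is ordered by: $s>0$ iff the coefficient of $\mathfrak d_s:=\max\operatorname{supp}s$ is positive. Write $s\preccurlyeq t$ (resp. $s\prec t$) if $s=0$ or $s,t\neq0$ and $\mathfrak d_s\preccurlyeq\mathfrak d_t$ (resp. if $t\ne0$ and either $s=0$ or $\mathfrak d_s\prec\mathfrak d_t$), and $s\asymp t$ if $s\preccurlyeq t\preccurlyeq s$. A family $(s_i)_{i\in I}$ is summable if $\bigcup_i\operatorname{supp}s_i$ is well-ordered for $\succ$ and of size $<\kappa$, and each monomial lies in only finitely many $\operatorname{supp}s_i$; its sum is then formed coefficientwise. A $\mathbf K$-linear map is strongly linear if it sends summable families to summable families and commutes with their sums. Let $\mathfrak M,\mathfrak N$ be non-trivial linearly ordered abelian groups, $\mathbb S=\mathbf K[\![\mathfrak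 M]\!]$ and $\mathbb T=\mathbf K[\![\mathfrak N]\!]$. Let $\ell:(\mathfrak M,\cdot,\prec)\to(\mathbb S,+,<)$ be an embedding of ordered groups and let $\partial:s\mapsto s'$ be a strongly linear derivation on $\mathbb S$ with $\ell(\mathfrak m)'=\mathfrak m^\dagger:=\mathfrak m'/\mathfrak m$ for all $\mathfrak m\in\mathfrak M$. Let $\triangle:\mathbb S\to\mathbb T$ be a strongly linear morphism of ordered rings. Let $x\in\mathbb S\setminus\{0\}$ be such that, for every $\mathfrak m\in\mathfrak M$, either $\mathfrak m^\dagger\preccurlyeq x^{-1}$ and $\mathfrak n^\dagger\preccurlyeq x^{-1}$ for all $\mathfrak n\in\operatorname{supp}\mathfrak m'$, or $\mathfrak m^\dagger\succ x^{-1}$ and $\mathfrak n^\dagger\asymp\mathfrak m^\dagger$ for all $\mathfrak n\in\operatorname{supp}\mathfrak m'$. Let $\delta\in\mathbb T$ with $\delta\prec\triangle(x)$. Then the set $$\mathfrak M_{\triangle,\delta}=\{\mathfrak m\in\mathfrak M:\triangle(\mathfrak m^\dagger)\,\delta\prec1\}$$ is a subgroup of $\mathfrak M$, and $\mathbb S_{\triangle,\delta}=\mathbf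 K[\![\mathfrak M_{\triangle,\delta}]\!]=\{s\in\mathbb S:\operatorname{supp}s\subseteq\mathfrak M_{\triangle,\delta}\}$ is a subfield of $\mathbb S$ containing $\mathbf K$ and closed under $\partial$. For every $s\in\mathbb S_{\triangle,\delta}$ the family $\left(\frac{\triangle(s^{(k)})}{k!}\delta^k\right)_{k\in\mathbb N}$ is summable in $\mathbb T$, and the map $$\mathbb S_{\triangle,\delta}\longrightarrow\mathbb T,\qquad s\longmapsto\sum_{k\in\mathbb N}\frac{\triangle(s^{(k)})}{k!}\,\delta^k$$ is a strongly linear morphism of ordered rings (and of $\mathbf K$-algebras). -/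

import Mathlib

open HahnSeries Cardinal

universe u v

noncomputable section

namespace HahnTaylor

variable {Γ Δ : Type u} {K : Type v}
variable [AddCommGroup Γ] [LinearOrder Γ] [IsOrderedAddMonoid Γ]
variable [AddCommGroup Δ] [LinearOrder Δ] [IsOrderedAddMonoid Δ]
variable [Field K] {κ : Cardinal.{u}} [Fact (ℵ₀ < κ)]

/-- The Hahn field `K⟦𝔐⟧` of Noetherian series whose supports are sets of size `< κ`.
The linearly ordered group `𝔐` of monomials is written additively and with the opposite order:
`γ : Γ` stands for the monomial `t ^ γ`, and `t ^ γ ≺ t ^ η` means `η < γ`. Thus a set of monomials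
is Noetherian for `≻` exactly when the set of its exponents is well-ordered in `Γ`.
If `κ` exceeds the cardinality of `Γ`, then every series with Noetherian support is allowed. -/
abbrev Series (Γ : Type u) (K : Type v) [AddCommGroup Γ] [LinearOrder Γ] [IsOrderedAddMonoid Γ]
    [Field K] (κ : Cardinal.{u}) [Fact (ℵ₀ < κ)] : Type (max u v) :=
  ↥(cardSuppLTSubfield Γ K κ)

/-- The term `c t ^ γ`. -/
def term (κ : Cardinal.{u}) [hκ : Fact (ℵ₀ < κ)] (γ : Γ) (c : K) : Series Γ K κ :=
  ⟨single γ c, (cardSupp_single_le γ c).trans_lt (one_lt_aleph0.trans hκ.out)⟩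

/-- The monomial `t ^ γ`. -/
def monomial (K : Type v) [Field K] (κ : Cardinal.{u}) [Fact (ℵ₀ < κ)] (γ : Γ) : Series Γ K κ :=
  term κ γ 1

/-- The embedding of `K` into `K⟦𝔐⟧` as the constant series. -/
def const (Γ : Type u) (K : Type v) [AddCommGroup Γ] [LinearOrder Γ] [IsOrderedAddMonoid Γ]
    [Field K] (κ : Cardinal.{u}) [Fact (ℵ₀ < κ)] : K →+* Series Γ K κ where
  toFun c := term κ 0 c
  map_one' := rfl
  map_zero' := Subtype.ext (C : K →+* HahnSeries Γ K).map_zero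
  map_add' a b := Subtype.ext ((C : K →+* HahnSeries Γ K).map_add a b)
  map_mul' a b := Subtype.ext ((C : K →+* HahnSeries Γ K).map_mul a b)

instance : Algebra K (Series Γ K κ) := (const Γ K κ).toAlgebra

/-- The support of a series. -/
def supp (s : Series Γ K κ) : Set Γ := (s : HahnSeries Γ K).support

/-- `s ≼ t`: the dominant monomial of `s` is at most that of `t` (or `s = 0`). -/
def Dominated (s t : Series Γ K κ) : Prop :=
  (t : HahnSeries Γ K).orderTop ≤ (s : HahnSeries Γ K).orderTop

/-- `s ≺ t`: `t ≠ 0` and the dominant monomial of `s` is below that of `t` (or `s = 0`). -/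
def StrictlyDominated (s t : Series Γ K κ) : Prop :=
  (t : HahnSeries Γ K).orderTop < (s : HahnSeries Γ K).orderTop

/-- `s ≍ t`. -/
def Asymp (s t : Series Γ K κ) : Prop := Dominated s t ∧ Dominated t s

/-- The ordering of `K⟦𝔐⟧`: `s < t` means that the leading coefficient of `t - s` is positive. -/
def Less [LinearOrder K] (s t : Series Γ K κ) : Prop :=
  0 < ((t - s : Series Γ K κ) : HahnSeries Γ K).leadingCoeff

/-- A family of series is summable if the union of its supports is a Noetherian set (of size
`< κ`), and each monomial lies in only finitely many of the supports. -/
structure IsSummable {I : Type*} (s : I → Series Γ K κ) : Prop where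
  isPWO : (⋃ i, supp (s i)).IsPWO
  card_lt : #(⋃ i, supp (s i) : Set Γ) < κ
  finite : ∀ γ : Γ, {i | γ ∈ supp (s i)}.Finite

/-- The family `s` is summable and its sum is `t`. -/
def HasFormalSum {I : Type*} (s : I → Series Γ K κ) (t : Series Γ K κ) : Prop :=
  IsSummable s ∧
    ∀ γ : Γ, (t : HahnSeries Γ K).coeff γ = ∑ᶠ i, (s i : HahnSeries Γ K).coeff γ

/-- A `K`-linear map which sends summable families to summable families and commutes with their
sums. The index types range over the universe of the monomials; this covers all summable families
up to reindexing and deletion of zero members, since each monomial lies in finitely many of the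
supports. -/
def IsStronglyLinear (Φ : Series Γ K κ →ₗ[K] Series Δ K κ) : Prop :=
  ∀ (I : Type u) (s : I → Series Γ K κ) (t : Series Γ K κ),
    HasFormalSum s t → HasFormalSum (fun i => Φ (s i)) (Φ t)

/-- Strong linearity of a `K`-linear map which is defined on a subfield of `K⟦𝔐⟧`. -/
def IsStronglyLinearFrom (F : IntermediateField K (Series Γ K κ)) (Φ : F →ₗ[K] Series Δ K κ) :
    Prop :=
  ∀ (I : Type u) (s : I → F) (t : F),
    HasFormalSum (fun i => (s i : Series Γ K κ)) (t : Series Γ K κ) →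
      HasFormalSum (fun i => Φ (s i)) (Φ t)

/-- The logarithmic derivative `s† = s' / s`. -/
def logDer (der : Derivation K (Series Γ K κ) (Series Γ K κ)) (s : Series Γ K κ) : Series Γ K κ :=
  der s / s

/-- `(K⟦𝔐⟧, ℓ, ∂)` is a differential pre-logarithmic Hahn field: `ℓ` embeds the ordered group `𝔐`
into the ordered additive group `K⟦𝔐⟧` (recall that `γ < η` means `t ^ η ≺ t ^ γ`), the derivation
`∂` is strongly linear, and `∂ (ℓ 𝔪) = ∂ 𝔪 / 𝔪` for all monomials `𝔪`. -/
structure IsDifferentialPreLogarithmic [LinearOrder K] (l : Γ →+ Series Γ K κ)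
    (der : Derivation K (Series Γ K κ) (Series Γ K κ)) : Prop where
  log_lt : ∀ γ η : Γ, γ < η → Less (l η) (l γ)
  stronglyLinear : IsStronglyLinear (der : Series Γ K κ →ₗ[K] Series Γ K κ)
  der_log : ∀ γ : Γ, der (l γ) = logDer der (monomial K κ γ)

/-- For every monomial `𝔪`, either `𝔪† ≼ x⁻¹` and `𝔫† ≼ x⁻¹` for all `𝔫 ∈ supp 𝔪'`, or
`𝔪† ≻ x⁻¹` and `𝔫† ≍ 𝔪†` for all `𝔫 ∈ supp 𝔪'`. -/
def DerivativeDichotomy (der : Derivation K (Series Γ K κ) (Series Γ K κ)) (x : Series Γ K κ) :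
    Prop :=
  ∀ γ : Γ,
    (Dominated (logDer der (monomial K κ γ)) x⁻¹ ∧
      ∀ η ∈ supp (der (monomial K κ γ)), Dominated (logDer der (monomial K κ η)) x⁻¹) ∨
    (StrictlyDominated x⁻¹ (logDer der (monomial K κ γ)) ∧
      ∀ η ∈ supp (der (monomial K κ γ)),
        Asymp (logDer der (monomial K κ η)) (logDer der (monomial K κ γ)))

/-- `𝔐_{△,δ} = {𝔪 : △(𝔪†) δ ≺ 1}`. -/
def taylorMonomials (der : Derivation K (Series Γ K κ) (Series Γ K κ))
    (tri : Series Γ K κ →ₐ[K] Series Δ K κ) (δ : Series Δ K κ) : Set Γ :=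
  {γ | StrictlyDominated (tri (logDer der (monomial K κ γ)) * δ) 1}

/-- `𝕊_{△,δ} = K⟦𝔐_{△,δ}⟧`, the class of series with support in `𝔐_{△,δ}`. -/
def taylorSeries (der : Derivation K (Series Γ K κ) (Series Γ K κ))
    (tri : Series Γ K κ →ₐ[K] Series Δ K κ) (δ : Series Δ K κ) : Set (Series Γ K κ) :=
  {s | supp s ⊆ taylorMonomials der tri δ}

/-- The `k`-th term `△(s⁽ᵏ⁾) δᵏ / k!` of the Taylor deformation of `△` at `s`. -/
def taylorTerm (der : Derivation K (Series Γ K κ) (Series Γ K κ))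
    (tri : Series Γ K κ →ₐ[K] Series Δ K κ) (δ : Series Δ K κ) (s : Series Γ K κ) (k : ℕ) :
    Series Δ K κ :=
  tri (der^[k] s) / (k.factorial : Series Δ K κ) * δ ^ k

end HahnTaylor

end

open HahnTaylor

/-! Write `τ γ` for the order of `△(t ^ γ)`, `d` for the order of `δ`, and `M` for the set of
exponents `γ` with `△((t ^ γ)†) δ ≺ 1`; it is a group because `γ ↦ (t ^ γ)†` is additive.
Everything follows from the summability of the family of all `△((t ^ γ)⁽ᵏ⁾) δ ^ k / k!` for
`k ∈ ℕ` and `γ` in a well-ordered subset of `M` (`isSummable_taylorTerm`). Granted this, the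
Taylor map `T` is obtained by summation, it is strongly linear by an exchange of sums,
multiplicative by the iterated Leibniz rule, and order preserving since `T s` and `△ s` have the
same leading term: for `γ ∈ M`, each derivation, together with the corresponding factor `δ`,
strictly increases the order.

For a fixed `k` the summability is the strong linearity of the maps involved. So it remains to
exclude sequences of exponents `ω n + k n • d`, with `ω n` in the support of `△` of a `k n`-th
derivative and `k n` strictly increasing, which are nonincreasing (`not_antitone_reach`). The
exponents of iterated derivatives are reached in steps `q ↦ q + η` with `η` in the support of
`(t ^ q)†`. The dichotomy for `x` gives bounds `-e i ≤ η` for these steps, where `τ (e i) < d`,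
and where `e` is either constant or a strictly increasing sequence.

The `k`-fold multiplication by `δ` is not the image of a multiplication by a monomial of the
source, so strong linearity cannot be used for all `k` at once. It is therefore replaced by an
approximation: the value of `t ^ q δ ^ k` is taken to be `π (τ q) + k • ε` in a suitable ordered
group, where `ε` stands for `τ e` if `e` is constant (`not_antitone_of_const_bound`) and for the
limit of the sequence `τ (e i)`, formed in an ultrapower, otherwise
(`not_antitone_of_strictMono_bound`). A sequence of pairs `(q n, k n)` with increasing values can
be corrected by elements `g n` of the group `E` generated by the `e i` to a monotone sequence
`q n + g n`, to which strong linearity applies; the correction costs only supports relative to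
elements of `E`, and these are contained in one well-ordered set. For a constant `e` this is
clear; for a sequence it is the gliding hump argument of `SupportOp.isPWO_of_cauchy`. A minimal
bad sequence argument (`not_isBadSeq_of_gauge`) combines these facts: the predecessors of the
members of a minimal bad sequence have a subsequence with strictly increasing values, and the
correction shows that the members increase somewhere as well. -/

set_option linter.unusedSectionVars false

noncomputable section

namespace HahnTaylor

/-! ### Subsequences -/

theorem exists_strictMono_or_antitone_subseq {α : Type*} [LinearOrder α] (f : ℕ → α) :
    ∃ φ : ℕ ↪o ℕ, StrictMono (f ∘ φ) ∨ Antitone (f ∘ φ) := by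
  obtain ⟨φ, h | h⟩ := exists_increasing_or_nonincreasing_subseq (· < ·) f
  · exact ⟨φ, Or.inl fun m n hmn => h m n hmn⟩
  · refine ⟨φ, Or.inr fun m n hmn => ?_⟩
    rcases hmn.eq_or_lt with rfl | hmn
    · exact le_rfl
    · exact not_lt.1 (h m n hmn)

theorem exists_strictAnti_or_monotone_subseq {α : Type*} [LinearOrder α] (f : ℕ → α) :
    ∃ φ : ℕ ↪o ℕ, StrictAnti (f ∘ φ) ∨ Monotone (f ∘ φ) :=
  exists_strictMono_or_antitone_subseq (α := αᵒᵈ) f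

theorem exists_strictMono_or_const_subseq (k : ℕ → ℕ) :
    ∃ φ : ℕ ↪o ℕ, StrictMono (k ∘ φ) ∨ ∀ n, k (φ n) = k (φ 0) := by
  obtain ⟨φ, h | h⟩ := exists_strictMono_or_antitone_subseq k
  · exact ⟨φ, Or.inl h⟩
  obtain ⟨ψ, h' | h'⟩ := exists_strictAnti_or_monotone_subseq (k ∘ φ)
  · exact absurd h' (not_strictAnti_of_wellFoundedLT _)
  · refine ⟨ψ.trans φ, Or.inr fun n => le_antisymm ?_ ?_⟩
    · exact h (ψ.monotone (Nat.zero_le n))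
    · exact h' (Nat.zero_le n)

theorem not_strictAnti_of_mem_isPWO {α : Type*} [Preorder α] {s : Set α} (hs : s.IsPWO)
    {f : ℕ → α} (hf : ∀ n, f n ∈ s) : ¬ StrictAnti f := fun h => by
  obtain ⟨φ, hφ⟩ := hs.exists_monotone_subseq hf
  exact lt_irrefl _ ((hφ (Nat.zero_le 1)).trans_lt (h (φ.strictMono Nat.zero_lt_one)))

theorem isPWO_of_forall_not_strictAnti {α : Type*} [LinearOrder α] {s : Set α}
    (hs : ∀ f : ℕ → α, (∀ n, f n ∈ s) → ¬ StrictAnti f) : s.IsPWO := by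
  rw [Set.isPWO_iff_exists_monotone_subseq]
  intro f hf
  obtain ⟨φ, h | h⟩ := exists_strictAnti_or_monotone_subseq f
  · exact absurd h (hs _ fun n => hf _)
  · exact ⟨φ, h⟩

/-! ### Quotients by convex subgroups -/

/-- The quotient of a linearly ordered abelian group by a convex subgroup is a linearly ordered
abelian group, and the projection is monotone. -/
theorem exists_convex_quotient {H : Type u} [AddCommGroup H] [LinearOrder H]
    [IsOrderedAddMonoid H] (J : AddSubgroup H)
    (hJ : ∀ a ∈ J, ∀ b, 0 ≤ b → b ≤ a → b ∈ J) :
    ∃ (L : Type u) (_ : AddCommGroup L) (_ : LinearOrder L) (_ : IsOrderedAddMonoid L)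
      (π : H →+ L), Monotone π ∧ Function.Surjective π ∧ ∀ x, π x = 0 ↔ x ∈ J := by
  classical
  let C : AddGroupCone (H ⧸ J) :=
    { carrier := QuotientAddGroup.mk '' {x : H | 0 ≤ x}
      zero_mem' := ⟨0, le_rfl, rfl⟩
      add_mem' := by
        rintro _ _ ⟨x, hx, rfl⟩ ⟨y, hy, rfl⟩
        exact ⟨x + y, add_nonneg hx hy, rfl⟩
      eq_zero_of_mem_of_neg_mem' := by
        rintro _ ⟨x, hx, rfl⟩ ⟨y, hy, hxy⟩
        rw [← QuotientAddGroup.mk_neg, QuotientAddGroup.eq] at hxy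
        rw [QuotientAddGroup.eq_zero_iff]
        refine hJ (x + y) ?_ x hx (le_add_of_nonneg_right hy)
        have := J.neg_mem hxy
        simpa [add_comm] using this }
  have htot : ∀ a : H ⧸ J, a ∈ C ∨ -a ∈ C := by
    intro a
    obtain ⟨x, rfl⟩ := QuotientAddGroup.mk_surjective a
    rcases le_total 0 x with h | h
    · exact Or.inl ⟨x, h, rfl⟩
    · exact Or.inr ⟨-x, neg_nonneg.2 h, rfl⟩
  have : HasMemOrNegMem C := ⟨htot⟩
  let _ : LinearOrder (H ⧸ J) := LinearOrder.mkOfAddGroupCone C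
  have : IsOrderedAddMonoid (H ⧸ J) := IsOrderedAddMonoid.mkOfCone C
  refine ⟨H ⧸ J, inferInstance, inferInstance, inferInstance, QuotientAddGroup.mk' J, ?_,
    QuotientAddGroup.mk'_surjective J, fun x => QuotientAddGroup.eq_zero_iff x⟩
  intro x y hxy
  exact ⟨y - x, sub_nonneg.2 hxy, rfl⟩

/-! ### Support operators -/

section

variable {Γ Δ L : Type*}
variable [AddCommGroup Γ] [LinearOrder Γ] [IsOrderedAddMonoid Γ]
variable [AddCommGroup Δ] [LinearOrder Δ] [IsOrderedAddMonoid Δ]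
variable [AddCommGroup L] [LinearOrder L] [IsOrderedAddMonoid L]

/-- The calculus of relative supports. For a strongly linear operator `Φ`, the set `Θ γ` stands for
the support of `Φ (t ^ γ) / t ^ (τ γ)`; the axioms record how this set depends on `γ` if `Φ` is
multiplicative, and that `Φ` respects the summability of families of monomials. -/
structure SupportOp (τ : Γ →+ Δ) (Θ : Γ → Set Δ) : Prop where
  zero : Θ 0 ⊆ {0}
  add : ∀ a b, ∀ θ ∈ Θ (a + b), ∃ α ∈ Θ a, ∃ β ∈ Θ b, α + β = θ
  neg : ∀ a, Θ (-a) ⊆ AddSubmonoid.closure (Θ a)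
  pwo : ∀ a : ℕ → Γ, Monotone a → (⋃ n, (fun θ => τ (a n) + θ) '' Θ (a n)).IsPWO

variable {τ : Γ →+ Δ} {Θ : Γ → Set Δ}

/-- The exponents whose relative supports are mapped into a given submonoid form a subgroup. -/
def SupportOp.absorbed (h : SupportOp τ Θ) (π : Δ →+ L) (C : AddSubmonoid L) : AddSubgroup Γ where
  carrier := {a | ∀ θ ∈ Θ a, π θ ∈ C}
  zero_mem' := by
    intro θ hθ
    rw [h.zero hθ, map_zero]
    exact C.zero_mem
  add_mem' := by
    intro a b ha hb θ hθ
    obtain ⟨α, hα, β, hβ, rfl⟩ := h.add a b θ hθ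
    rw [map_add]
    exact C.add_mem (ha α hα) (hb β hβ)
  neg_mem' := by
    intro a ha θ hθ
    have : AddSubmonoid.closure (Θ a) ≤ C.comap π := AddSubmonoid.closure_le.2 ha
    exact this (h.neg a hθ)

/-- Along a sequence `q` whose values `π (τ (q n)) + c n` are approximated by a monotone sequence
`q n + g n` of exponents, a choice of elements in the relative supports cannot destroy the
monotonicity of the values. -/
theorem SupportOp.exists_lt_of_approx (h : SupportOp τ Θ) {π : Δ →+ L} (hπ : Monotone π)
    {Z : Set L} (hZ : Z.IsPWO) {q g : ℕ → Γ} {c : ℕ → L} (hx : Monotone fun n => q n + g n)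
    (hg : ∀ n, ∀ θ ∈ Θ (-g n), π θ ∈ Z) (hc : StrictMono fun n => c n - π (τ (g n)))
    {θ : ℕ → Δ} (hθ : ∀ n, θ n ∈ Θ (q n)) :
    ∃ i j, i < j ∧ π (τ (q i)) + c i + π (θ i) < π (τ (q j)) + c j + π (θ j) := by
  have key : ∀ n, ∃ α ∈ Θ (q n + g n), ∃ β ∈ Θ (-g n), α + β = θ n := fun n =>
    h.add _ _ _ (by simpa using hθ n)
  choose α hα β hβ hαβ using key
  obtain ⟨φ, hφ⟩ := (h.pwo _ hx).exists_monotone_subseq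
    (f := fun n => τ (q n + g n) + α n) fun n => Set.mem_iUnion.2 ⟨n, α n, hα n, rfl⟩
  obtain ⟨ψ, hψ⟩ := hZ.exists_monotone_subseq (f := fun n => π (β (φ n)))
    fun n => hg _ _ (hβ _)
  refine ⟨φ (ψ 0), φ (ψ 1), φ.strictMono (ψ.strictMono Nat.zero_lt_one), ?_⟩
  have e1 := hπ (hφ (ψ.monotone (Nat.zero_le 1)))
  have e2 := hψ (Nat.zero_le 1)
  have e3 := hc (φ.strictMono (ψ.strictMono Nat.zero_lt_one))
  simp only [Function.comp, map_add] at e1 e2 e3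
  have key : ∀ n, π (τ (q n)) + c n + π (θ n) =
      (π (τ (q n)) + π (τ (g n)) + π (α n)) + π (β n) + (c n - π (τ (g n))) := by
    intro n
    rw [← hαβ n, map_add]
    abel
  rw [key, key]
  exact add_lt_add_of_le_of_lt (add_le_add e1 e2) e3

/-! ### Noetherianity of the reachable exponents -/

/-- The exponents which can be reached from the set `A` in exactly `k` steps, where each step adds
to the current exponent `q` an element of `D q`. -/
inductive Reach (D : Γ → Set Γ) (A : Set Γ) : Γ → ℕ → Prop
  | base {q : Γ} : q ∈ A → Reach D A q 0
  | step {q η : Γ} {k : ℕ} : Reach D A q k → η ∈ D q → Reach D A (q + η) (k + 1)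

/-- The ordered group `L` and the element `ε` serve to compare the terms `t ^ ω δ ^ k`: the value of
such a term is `π ω + k ε`. The derivation strictly increases values, and sequences of exponents
with strictly increasing values can be approximated by monotone sequences of exponents, where the
error lies in a subgroup of exponents with controlled relative supports. -/
structure Gauge (τ : Γ →+ Δ) (D : Γ → Set Γ) (ΘD ΘU : Γ → Set Δ) (A : Set Γ) (π : Δ →+ L)
    (ε : L) : Prop where
  mono : Monotone π
  step : ∀ q k η, Reach D A q k → η ∈ D q → 0 < π (τ η) + ε
  approx : ∃ (E : AddSubgroup Γ) (ZD ZU : Set L), ZD.IsPWO ∧ ZU.IsPWO ∧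
    (∀ a ∈ E, ∀ θ ∈ ΘD a, π θ ∈ ZD) ∧ (∀ a ∈ E, ∀ θ ∈ ΘU a, π θ ∈ ZU) ∧
    ∀ (q : ℕ → Γ) (k : ℕ → ℕ), StrictMono k → StrictMono (fun n => π (τ (q n)) + k n • ε) →
      ∃ g : ℕ → Γ, (∀ n, g n ∈ E) ∧ Monotone (fun n => q n + g n) ∧
        StrictMono fun n => k n • ε - π (τ (g n))

variable {D : Γ → Set Γ} {ΘD ΘU : Γ → Set Δ} {A : Set Γ} {π : Δ →+ L} {ε : L} {d : Δ}

/-- The relation whose bad sequences are the sequences of reachable exponents with nonincreasing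
values, where equal values are attained after distinct numbers of steps. -/
def GaugeLT (τ : Γ →+ Δ) (π : Δ →+ L) (ε : L) (P Q : Γ × ℕ) : Prop :=
  π (τ P.1) + P.2 • ε < π (τ Q.1) + Q.2 • ε ∨
    (π (τ P.1) + P.2 • ε = π (τ Q.1) + Q.2 • ε ∧ P.2 = Q.2)

/-- In a minimal bad sequence, the predecessors of the members have strictly smaller values. By
minimality they contain a subsequence with strictly increasing values, and then so do the members
themselves. -/
theorem not_isBadSeq_of_gauge (hτ : Monotone τ) (hD : SupportOp τ ΘD)
    (hDΘ : ∀ q, ∀ η ∈ D q, d + τ η ∈ ΘD q)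
    (hR : ∀ k, {q | Reach D A q k}.IsPWO) (hG : Gauge τ D ΘD ΘU A π ε) (f : ℕ → Γ × ℕ) :
    ¬ Set.PartiallyWellOrderedOn.IsBadSeq (GaugeLT τ π ε) {P | Reach D A P.1 P.2} f := by
  intro hbad
  obtain ⟨f, hf, hmin⟩ := Set.PartiallyWellOrderedOn.exists_min_bad_of_exists_bad
    (GaugeLT τ π ε) Prod.snd _ ⟨f, hbad⟩
  clear hbad
  obtain ⟨hfR, hfbad⟩ := hf
  have hanti : ∀ m n, m < n →
      π (τ (f n).1) + (f n).2 • ε ≤ π (τ (f m).1) + (f m).2 • ε := fun m n hmn =>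
    not_lt.1 fun h => hfbad m n hmn (Or.inl h)
  obtain ⟨φ, hφ⟩ : ∃ φ : ℕ ↪o ℕ, StrictMono fun n => (f (φ n)).2 := by
    obtain ⟨φ, hφ | hφ⟩ := exists_strictMono_or_const_subseq fun n => (f n).2
    · exact ⟨φ, hφ⟩
    exfalso
    -- The exponents reached in a fixed number of steps are well-ordered.
    refine not_strictAnti_of_mem_isPWO (hR (f (φ 0)).2) (f := fun n => (f (φ n)).1) (fun n => ?_) ?_
    · have := hfR (φ n)
      simp only [Set.mem_ofPred_eq] at this ⊢
      rwa [hφ n] at this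
    · intro m n hmn
      by_contra hle
      rw [not_lt] at hle
      have hlt := φ.strictMono hmn
      have h1 := hanti _ _ hlt
      rw [hφ m, hφ n, add_le_add_iff_right] at h1
      refine hfbad _ _ hlt (Or.inr ⟨?_, by rw [hφ m, hφ n]⟩)
      rw [hφ m, hφ n, le_antisymm (hG.mono (hτ hle)) h1]
  -- Shifting the subsequence by one, all members have predecessors.
  have hpred : ∀ n, ∃ q η k, Reach D A q k ∧ η ∈ D q ∧ f (φ (n + 1)) = (q + η, k + 1) := by
    intro n
    have hpos : (f (φ (n + 1))).2 ≠ 0 := (Nat.zero_le _).trans_lt (hφ n.lt_succ_self) |>.ne'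
    have hr := hfR (φ (n + 1))
    generalize f (φ (n + 1)) = P at hpos hr
    obtain ⟨p, k⟩ := P
    cases hr with
    | base _ => exact absurd rfl hpos
    | step h1 h2 => exact ⟨_, _, _, h1, h2, rfl⟩
  choose q η k hqk hη hf using hpred
  have hk : StrictMono k := by
    intro m n hmn
    have := hφ (Nat.succ_lt_succ hmn)
    simp only [Nat.succ_eq_add_one, hf] at this
    omega
  have hlt : ∀ n, π (τ (q n)) + k n • ε <
      π (τ (f (φ (n + 1))).1) + (f (φ (n + 1))).2 • ε := by
    intro n
    rw [hf n]
    have := hG.step _ _ _ (hqk n) (hη n)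
    simp only [map_add, succ_nsmul]
    calc _ < π (τ (q n)) + k n • ε + (π (τ (η n)) + ε) := lt_add_of_pos_right _ this
      _ = _ := by abel
  obtain ⟨ψ, hψ | hψ⟩ := exists_strictMono_or_antitone_subseq fun n => π (τ (q n)) + k n • ε
  · obtain ⟨E, ZD, -, hZD, -, hED, -, happ⟩ := hG.approx
    obtain ⟨g, hgE, hgx, hgc⟩ := happ (q ∘ ψ) (k ∘ ψ) (hk.comp ψ.strictMono) hψ
    obtain ⟨i, j, hij, h⟩ := hD.exists_lt_of_approx hG.mono hZD (c := fun n => k (ψ n) • ε) hgx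
      (fun n θ hθ => hED _ (E.neg_mem (hgE n)) θ hθ) hgc
      (θ := fun n => d + τ (η (ψ n))) fun n => hDΘ _ _ (hη _)
    have h' := hanti _ _ (φ.strictMono (Nat.succ_lt_succ (ψ.strictMono hij)))
    simp only [Nat.succ_eq_add_one, hf] at h'
    simp only [map_add, succ_nsmul, Function.comp] at h h'
    refine absurd h (not_lt.2 ?_)
    calc _ = π (τ (q (ψ j))) + π (τ (η (ψ j))) + (k (ψ j) • ε + ε) + (π d - ε) := by abel
      _ ≤ π (τ (q (ψ i))) + π (τ (η (ψ i))) + (k (ψ i) • ε + ε) + (π d - ε) :=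
        add_le_add_left h' _
      _ = _ := by abel
  · -- Replacing a tail of `f` by predecessors yields a bad sequence which is smaller than `f`.
    set N := φ (ψ 0 + 1) with hN
    refine hmin N (fun n => if n < N then f n else (q (ψ (n - N)), k (ψ (n - N))))
      (fun m hm => by simp [hm]) (by simp [hN, hf]) ⟨fun n => ?_, fun m n hmn => ?_⟩
    · by_cases h : n < N
      · simpa [h] using hfR n
      · simpa [h] using hqk _
    · by_cases hn : n < N
      · simpa [hn, hmn.trans hn] using hfbad m n hmn
      by_cases hm : m < N
      · simp only [hn, hm, if_true, if_false]
        have h1 := hlt (ψ (n - N))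
        have h2 := hanti m (φ (ψ (n - N) + 1)) (hm.trans_le
          (φ.monotone (Nat.succ_le_succ (ψ.monotone (Nat.zero_le _)))))
        rintro (h | h)
        · exact lt_asymm h (h1.trans_le h2)
        · exact absurd h.1 (h1.trans_le h2).ne'
      · simp only [hn, hm, if_false]
        have hmn' : m - N < n - N := by omega
        rintro (h | h)
        · exact not_le.2 h (hψ hmn'.le)
        · exact absurd h.2 (hk (ψ.strictMono hmn')).ne

/-- The supports of the images of the reachable exponents under a second operator admit no bad
sequence either. -/
theorem not_antitone_of_gauge (hτ : Monotone τ) (hD : SupportOp τ ΘD) (hU : SupportOp τ ΘU)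
    (hDΘ : ∀ q, ∀ η ∈ D q, d + τ η ∈ ΘD q)
    (hR : ∀ k, {q | Reach D A q k}.IsPWO) (hG : Gauge τ D ΘD ΘU A π ε)
    {q : ℕ → Γ} {k : ℕ → ℕ} {θ : ℕ → Δ} (hq : ∀ n, Reach D A (q n) (k n)) (hk : StrictMono k)
    (hθ : ∀ n, θ n ∈ ΘU (q n)) : ¬ Antitone fun n => π (τ (q n) + θ n) + k n • ε := by
  intro hanti
  obtain ⟨ψ, hψ | hψ⟩ := exists_strictMono_or_antitone_subseq fun n => π (τ (q n)) + k n • ε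
  · obtain ⟨E, -, ZU, -, hZU, -, hEU, happ⟩ := hG.approx
    obtain ⟨g, hgE, hgx, hgc⟩ := happ (q ∘ ψ) (k ∘ ψ) (hk.comp ψ.strictMono) hψ
    obtain ⟨i, j, hij, h⟩ := hU.exists_lt_of_approx hG.mono hZU (c := fun n => k (ψ n) • ε) hgx
      (fun n θ hθ => hEU _ (E.neg_mem (hgE n)) θ hθ) hgc (θ := θ ∘ ψ) fun n => hθ _
    have h' := hanti (ψ.monotone hij.le)
    simp only [map_add, Function.comp] at h h'
    rw [add_right_comm, add_right_comm _ _ (π (θ (ψ j)))] at h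
    exact not_lt.2 h' h
  · refine not_isBadSeq_of_gauge hτ hD hDΘ hR hG (fun n => (q (ψ n), k (ψ n)))
      ⟨fun n => hq _, fun m n hmn => ?_⟩
    rintro (h | h)
    · exact not_le.2 h (hψ hmn.le)
    · exact absurd h.2 (hk (ψ.strictMono hmn)).ne

end

section

variable {Γ Δ L : Type*}
variable [AddCommGroup Γ] [LinearOrder Γ] [IsOrderedAddMonoid Γ]
variable [AddCommGroup Δ] [LinearOrder Δ] [IsOrderedAddMonoid Δ]
variable [AddCommGroup L] [LinearOrder L] [IsOrderedAddMonoid L]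
variable {τ : Γ →+ Δ} {Θ : Γ → Set Δ}

/-! ### Relative supports along Cauchy sequences -/

theorem SupportOp.isPWO (h : SupportOp τ Θ) (a : Γ) : (Θ a).IsPWO := by
  have h1 := h.pwo (fun _ => a) monotone_const
  have h2 := h1.image_of_monotone (f := fun x => -τ a + x) fun x y hxy => by simpa using hxy
  refine h2.mono fun θ hθ => ⟨τ a + θ, Set.mem_iUnion.2 ⟨0, θ, hθ, rfl⟩, by simp⟩

theorem nonneg_of_mem_addSubmonoid_closure {s : Set L} (hs : ∀ x ∈ s, 0 ≤ x) {x : L}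
    (hx : x ∈ AddSubmonoid.closure s) : 0 ≤ x := by
  induction hx using AddSubmonoid.closure_induction with
  | mem x hx => exact hs x hx
  | zero => exact le_rfl
  | add x y _ _ hx hy => exact add_nonneg hx hy

/-- The values below which a set is not well-ordered. -/
def IsBadValue (Y : Set L) (y : L) : Prop := ¬ (Y ∩ Set.Iio y).IsPWO

theorem isPWO_setOf_not_isBadValue (Y : Set L) : {y ∈ Y | ¬ IsBadValue Y y}.IsPWO := by
  refine isPWO_of_forall_not_strictAnti fun f hf hanti => ?_
  refine (hf 0).2 fun h => not_strictAnti_of_mem_isPWO h (f := fun n => f (n + 1))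
    (fun n => ⟨(hf _).1, hanti n.succ_pos⟩) fun m n hmn => hanti (Nat.succ_lt_succ hmn)

theorem exists_isBadValue {Y : Set L} (hY : ¬ Y.IsPWO) : ∃ y ∈ Y, IsBadValue Y y := by
  by_contra! hne
  exact hY ((isPWO_setOf_not_isBadValue Y).mono fun y hy => ⟨hy, hne y hy⟩)

theorem IsBadValue.exists_lt {Y : Set L} {y : L} (hy : IsBadValue Y y) :
    ∃ z ∈ Y, z < y ∧ IsBadValue Y z := by
  by_contra! hne
  exact hy ((isPWO_setOf_not_isBadValue Y).mono fun z hz => ⟨hz.1, hne z hz.1 hz.2⟩)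

variable {π : Δ →+ L} {e : ℕ → Γ}

/-- One step of the gliding hump: an element `g` of the group generated by an initial segment of
the sequence `e` is moved by an increment `e n - e N'` which is smaller than `x`, so that the
relative support of the new element contains an element whose value is bad and smaller than that of
`y`. -/
theorem SupportOp.gliding_hump_step (h : SupportOp τ Θ) (hτ : Monotone τ) (hπ : Monotone π)
    (he : StrictMono e) (hC : ∀ x : Δ, 0 < π x → ∃ i, ∀ j, τ (e j) - τ (e i) < x)
    (hpos : ∀ i, ∀ θ ∈ Θ (e i), 0 ≤ θ) {g : Γ} {N : ℕ}
    (hg : g ∈ AddSubgroup.closure (e '' Set.Iic N)) {x : Δ} (hx : 0 < π x) {y : Δ}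
    (hy : IsBadValue (π '' ⋃ i, Θ (e i)) (π y)) :
    ∃ (N' n : ℕ) (a y' : Δ), N ≤ N' ∧ N' < n ∧ (∀ j, τ (e j) - τ (e N') < x) ∧
      a ∈ Θ (g + (e n - e N')) ∧ π a < π y ∧ π y' < π a ∧
      IsBadValue (π '' ⋃ i, Θ (e i)) (π y') := by
  set Y := π '' ⋃ i, Θ (e i) with hYdef
  have hY0 : ∀ z ∈ Y, 0 ≤ z := by
    rintro _ ⟨θ, hθ, rfl⟩
    obtain ⟨i, hi⟩ := Set.mem_iUnion.1 hθ
    simpa using hπ (hpos i θ hi)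
  obtain ⟨i₀, hi₀⟩ := hC x hx
  set N' := max i₀ N with hN'
  -- The monoid `Z` contains the values of the relative supports of `e 0, ..., e N'` and those
  -- values in `Y` which are not bad. It is well-ordered, so there is a value
  -- below `π y` outside of `Z`.
  set W := {z ∈ Y | ¬ IsBadValue Y z} ∪ ⋃ i ∈ Finset.range (N' + 1), π '' Θ (e i) with hW
  have hWY : W ⊆ Y := by
    rintro z (hz | hz)
    · exact hz.1
    · simp only [Set.mem_iUnion] at hz
      obtain ⟨i, -, θ, hθ, rfl⟩ := hz
      exact ⟨θ, Set.mem_iUnion.2 ⟨i, hθ⟩, rfl⟩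
  have hW0 : ∀ z ∈ W, 0 ≤ z := fun z hz => hY0 z (hWY hz)
  set Z := AddSubmonoid.closure W with hZ
  have hZpwo : (Z : Set L).IsPWO := by
    refine Set.IsPWO.addSubmonoid_closure hW0 ?_
    refine (isPWO_setOf_not_isBadValue Y).union ?_
    refine (Finset.isPWO_bUnion _).2 fun i _ => ?_
    exact (h.isPWO _).image_of_monotone hπ
  have hmemZ : ∀ i ≤ N', ∀ θ ∈ Θ (e i), π θ ∈ Z := fun i hi θ hθ =>
    AddSubmonoid.subset_closure (Or.inr (Set.mem_biUnion
      (Finset.mem_coe.2 (Finset.mem_range.2 (Nat.lt_succ_of_le hi))) ⟨θ, hθ, rfl⟩))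
  have habs : e N' - g ∈ h.absorbed π Z := by
    refine (h.absorbed π Z).sub_mem (hmemZ N' le_rfl) ?_
    refine (AddSubgroup.closure_le _).2 ?_ hg
    rintro _ ⟨i, hi, rfl⟩
    exact hmemZ i (le_trans hi (le_max_right _ _))
  obtain ⟨z, ⟨hzY, hzy⟩, hzZ⟩ : ∃ z ∈ Y ∩ Set.Iio (π y), z ∉ Z := by
    by_contra! hne
    exact hy (hZpwo.mono hne)
  obtain ⟨θ, hθ, rfl⟩ := hzY
  obtain ⟨n, hn⟩ := Set.mem_iUnion.1 hθ
  have hnN : N' < n := by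
    by_contra hle
    exact hzZ (hmemZ n (not_lt.1 hle) θ hn)
  have hSpwo : (π '' Θ (e n) \ Z).IsPWO :=
    ((h.isPWO _).image_of_monotone hπ).mono Set.sdiff_subset
  have hSne : (π '' Θ (e n) \ (Z : Set L)).Nonempty := ⟨π θ, ⟨θ, hn, rfl⟩, hzZ⟩
  obtain ⟨⟨s, hs, hsσ⟩, hσZ⟩ := hSpwo.isWF.min_mem hSne
  set σ := hSpwo.isWF.min hSne with hσ
  have hσle : ∀ θ ∈ Θ (e n), π θ ∉ Z → σ ≤ π θ := fun θ hθ hZ =>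
    hSpwo.isWF.min_le hSne ⟨⟨θ, hθ, rfl⟩, hZ⟩
  obtain ⟨α, hα, β, hβ, hαβ⟩ := h.add (g + (e n - e N')) (e N' - g) s (by
    convert hs using 2; abel)
  have hβZ : π β ∈ Z := habs β hβ
  -- The least value `σ` outside of `Z` in the relative support of `e n` persists in the relative
  -- support of `g + (e n - e N')`, since the two exponents differ by an element with values in `Z`.
  have hαZ : π α ∉ Z := fun hα => hσZ (by
    rw [← hsσ, ← hαβ, map_add]; exact Z.add_mem hα hβZ)
  have hασ : π α = σ := by
    refine le_antisymm ?_ ?_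
    · rw [← hsσ, ← hαβ, map_add]
      exact le_add_of_nonneg_right (nonneg_of_mem_addSubmonoid_closure hW0 hβZ)
    · obtain ⟨s', hs', β', hβ', hsβ⟩ := h.add (e n) (-(e N' - g)) α (by
        convert hα using 2; abel)
      have hβZ' : π β' ∈ Z := (h.absorbed π Z).neg_mem habs β' hβ'
      have : π s' ∉ Z := fun hs' => hαZ (by
        rw [← hsβ, map_add]; exact Z.add_mem hs' hβZ')
      rw [← hsβ, map_add]
      exact (hσle s' hs' this).trans
        (le_add_of_nonneg_right (nonneg_of_mem_addSubmonoid_closure hW0 hβZ'))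
  have hbad : IsBadValue Y σ := by
    by_contra hb
    exact hσZ (AddSubmonoid.subset_closure (Or.inl
      ⟨⟨s, Set.mem_iUnion.2 ⟨n, hs⟩, hsσ⟩, hb⟩))
  obtain ⟨_, ⟨y', -, rfl⟩, hy'σ, hy'⟩ := hbad.exists_lt
  refine ⟨N', n, α, y', le_max_right _ _, hnN, fun j => ?_, hα, ?_, ?_, hy'⟩
  · refine lt_of_le_of_lt ?_ (hi₀ j)
    exact sub_le_sub_left (hτ (he.monotone (le_max_left _ _))) _
  · rw [hασ]
    exact (hσle θ hn hzZ).trans_lt hzy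
  · rwa [hασ]

/-- If a strictly increasing sequence of exponents is Cauchy with respect to a coarsening `π` of the
order, then the union of their relative supports is well-ordered in the coarsening. Otherwise, a
gliding hump would lead to an increasing sequence of exponents whose increments are too small to
compensate the decrease of suitable elements in the relative supports. -/
theorem SupportOp.isPWO_of_cauchy (h : SupportOp τ Θ) (hτ : StrictMono τ) (hπ : Monotone π)
    (he : StrictMono e) (hC : ∀ x : Δ, 0 < π x → ∃ i, ∀ j, τ (e j) - τ (e i) < x)
    (hpos : ∀ i, ∀ θ ∈ Θ (e i), 0 ≤ θ) : (π '' ⋃ i, Θ (e i)).IsPWO := by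
  by_contra hY
  set Y := π '' ⋃ i, Θ (e i) with hYdef
  let S := {s : Γ × ℕ × Δ × Δ // s.1 ∈ AddSubgroup.closure (e '' Set.Iic s.2.1) ∧
    s.2.2.1 ∈ Θ s.1 ∧ π s.2.2.2 < π s.2.2.1 ∧ IsBadValue Y (π s.2.2.2)}
  have hnext : ∀ s : S, ∃ (s' : S) (N' : ℕ), s.1.2.1 ≤ N' ∧ N' < s'.1.2.1 ∧
      (∀ j, τ (e j) - τ (e N') < s.1.2.2.1 - s.1.2.2.2) ∧
      s'.1.1 = s.1.1 + (e s'.1.2.1 - e N') ∧ π s'.1.2.2.1 < π s.1.2.2.2 := by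
    rintro ⟨⟨g, N, a, y⟩, hg, ha, hya, hy⟩
    obtain ⟨N', n, a', y', h1, h2, h3, h4, h5, h6, h7⟩ :=
      h.gliding_hump_step hτ.monotone hπ he hC hpos hg
        (x := a - y) (by simpa using hya) hy
    refine ⟨⟨⟨_, n, a', y'⟩, ?_, h4, h6, h7⟩, N', h1, h2, h3, rfl, h5⟩
    refine add_mem (AddSubgroup.closure_mono (Set.image_mono
      (Set.Iic_subset_Iic.2 (h1.trans h2.le))) hg) (sub_mem ?_ ?_)
    · exact AddSubgroup.subset_closure ⟨n, Set.mem_Iic.2 le_rfl, rfl⟩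
    · exact AddSubgroup.subset_closure ⟨N', h2.le, rfl⟩
  choose next M hM1 hM2 hM3 hM4 hM5 using hnext
  obtain ⟨_, ⟨a, ha, rfl⟩, hay⟩ := exists_isBadValue hY
  obtain ⟨n, hn⟩ := Set.mem_iUnion.1 ha
  obtain ⟨_, ⟨y, -, rfl⟩, hya, hy⟩ := hay.exists_lt
  let s : ℕ → S := fun k => next^[k]
    ⟨⟨e n, n, a, y⟩, AddSubgroup.subset_closure ⟨n, Set.mem_Iic.2 le_rfl, rfl⟩, hn, hya, hy⟩
  have hs : ∀ k, s (k + 1) = next (s k) := fun k => Function.iterate_succ_apply' _ _ _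
  have hmono : Monotone fun k => (s k).1.1 := by
    refine monotone_nat_of_le_succ fun k => ?_
    rw [hs, hM4]
    exact le_add_of_nonneg_right (sub_nonneg.2 (he.monotone (hM2 _).le))
  have hlt : ∀ i j, i < j → τ (s j).1.1 - τ (s i).1.1 < (s i).1.2.2.1 - (s i).1.2.2.2 ∧
      π (s j).1.2.2.1 < π (s i).1.2.2.2 := by
    intro i j hij
    suffices H : τ (s j).1.1 - τ (s i).1.1 ≤ τ (e (s j).1.2.1) - τ (e (M (s i))) ∧
        π (s j).1.2.2.1 < π (s i).1.2.2.2 from ⟨H.1.trans_lt (hM3 _ _), H.2⟩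
    induction j, hij using Nat.le_induction with
    | base =>
      rw [hs]
      refine ⟨?_, hM5 _⟩
      rw [hM4, map_add, map_sub]
      simp
    | succ j hij ih =>
      refine ⟨?_, ?_⟩
      · have h1 : τ (e (s j).1.2.1) ≤ τ (e (M (s j))) := hτ.monotone (he.monotone (hM1 _))
        have h2 : τ (s (j + 1)).1.1 =
            τ (s j).1.1 + (τ (e (s (j + 1)).1.2.1) - τ (e (M (s j)))) := by
          rw [hs, hM4, map_add, map_sub]
        rw [h2]
        calc _ = τ (s j).1.1 - τ (s i).1.1 + (τ (e (s (j + 1)).1.2.1) - τ (e (M (s j)))) := by abel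
          _ ≤ τ (e (s j).1.2.1) - τ (e (M (s i))) +
              (τ (e (s (j + 1)).1.2.1) - τ (e (s j).1.2.1)) :=
            add_le_add ih.1 (sub_le_sub_left h1 _)
          _ = _ := by abel
      · have := hM5 (s j)
        rw [← hs] at this
        exact this.trans ((s j).2.2.2.1.trans ih.2)
  obtain ⟨φ, hφ⟩ := (h.pwo _ hmono).exists_monotone_subseq
    (f := fun k => τ (s k).1.1 + (s k).1.2.2.1)
    fun k => Set.mem_iUnion.2 ⟨k, _, (s k).2.2.1, rfl⟩
  have h1 := hφ (Nat.zero_le 1)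
  obtain ⟨h2, h3⟩ := hlt _ _ (φ.strictMono Nat.zero_lt_one)
  simp only [Function.comp] at h1
  refine not_le.2 h3 (hπ ?_)
  have h4 : (s (φ 0)).1.2.2.1 - (s (φ 1)).1.2.2.1 ≤ τ (s (φ 1)).1.1 - τ (s (φ 0)).1.1 := by
    rw [sub_le_sub_iff]
    calc _ = τ (s (φ 0)).1.1 + (s (φ 0)).1.2.2.1 := add_comm _ _
      _ ≤ _ := h1
  exact le_of_lt (lt_of_sub_pos (by
    have := sub_pos.2 (h4.trans_lt h2)
    calc (0 : Δ) < _ := this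
      _ = _ := by abel))

end

section

open Filter

/-! ### The limit of a sequence of exponents -/

/-- Over an ordered group, there is an element which behaves like the limit of a given strictly
increasing sequence: the class of the sequence in an ultrapower. -/
theorem exists_germ {Δ : Type u} [AddCommGroup Δ] [LinearOrder Δ] [IsOrderedAddMonoid Δ]
    {E : ℕ → Δ} (hE : StrictMono E) :
    ∃ (H : Type u) (_ : AddCommGroup H) (_ : LinearOrder H) (_ : IsOrderedAddMonoid H)
      (ι : Δ →+ H) (ω : H), StrictMono ι ∧ (∀ i, ι (E i) < ω) ∧
      (∀ (x y : Δ) (m n : ℕ), ι x + m • ω < ι y + n • ω →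
        ∃ᶠ j in atTop, x + m • E j < y + n • E j) ∧
      ∀ (x y : Δ) (m n : ℕ), (∀ j, x + m • E j ≤ y + n • E j) → ι x + m • ω ≤ ι y + n • ω := by
  have hcof : ∀ {P : ℕ → Prop}, (∀ᶠ j in atTop, P j) → ∀ᶠ j in (hyperfilter ℕ : Filter ℕ), P j := by
    intro P h
    rw [← Nat.cofinite_eq_atTop] at h
    exact hyperfilter_le_cofinite h
  refine ⟨Germ (hyperfilter ℕ : Filter ℕ) Δ, inferInstance, inferInstance, inferInstance,
    { toFun := fun x => (x : Germ (hyperfilter ℕ : Filter ℕ) Δ)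
      map_zero' := rfl
      map_add' := fun _ _ => rfl }, (E : Germ (hyperfilter ℕ : Filter ℕ) Δ), ?_, ?_, ?_, ?_⟩
  · exact fun x y h => Germ.const_lt h
  · intro i
    refine Germ.coe_lt.2 (hcof ?_)
    filter_upwards [eventually_gt_atTop i] with j hj using hE hj
  · intro x y m n h
    have h2 : ∃ᶠ j in (hyperfilter ℕ : Filter ℕ), x + m • E j < y + n • E j :=
      (Germ.coe_lt.1 h).frequently
    exact fun hn => h2 (hcof hn)
  · exact fun x y m n h => Germ.coe_le.2 (Eventually.of_forall h)

/-- For a strictly increasing sequence `E`, there are a coarsening `π` of the order and an element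
`ε` just above all `π (E i)`, so that inequalities between linear expressions in `ε` amount to
inequalities which hold at infinitely many places of the sequence. The group `L` is the quotient of
an ultrapower by the convex subgroup of the elements which are infinitesimal compared to the
distance of the sequence to its end. -/
theorem exists_limit {Δ : Type u} [AddCommGroup Δ] [LinearOrder Δ] [IsOrderedAddMonoid Δ]
    {E : ℕ → Δ} (hE : StrictMono E) :
    ∃ (L : Type u) (_ : AddCommGroup L) (_ : LinearOrder L) (_ : IsOrderedAddMonoid L)
      (π : Δ →+ L) (ε : L), Monotone π ∧ (∀ i, π (E i) < ε) ∧
      (∀ (x y : Δ) (m n : ℕ), π x + m • ε < π y + n • ε →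
        ∃ᶠ j in atTop, x + m • E j < y + n • E j) ∧
      (∀ (x y : Δ) (m n : ℕ), (∀ j, x + m • E j ≤ y + n • E j) → π x + m • ε ≤ π y + n • ε) ∧
      (∀ x, 0 < π x → ∃ i, ∀ j, E j - E i < x) ∧
      ∀ z, 0 < z → ∃ i, ∀ j, π (E j) - π (E i) ≤ z := by
  obtain ⟨H, _, _, _, ι, ω, hι, hω, hlt, hle⟩ := exists_germ hE
  have hιle : ∀ {x y}, x ≤ y → ι x ≤ ι y := fun h => hι.monotone h
  let J : AddSubgroup H :=
    { carrier := {z | ∀ i, ∃ j, ι (E i) + |z| ≤ ι (E j)}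
      zero_mem' := fun i => ⟨i, by simp⟩
      add_mem' := by
        intro a b ha hb i
        obtain ⟨j, hj⟩ := ha i
        obtain ⟨l, hl⟩ := hb j
        refine ⟨l, le_trans ?_ hl⟩
        calc _ ≤ ι (E i) + (|a| + |b|) := add_le_add_right (abs_add_le _ _) _
          _ = ι (E i) + |a| + |b| := (add_assoc _ _ _).symm
          _ ≤ _ := add_le_add_left hj _
      neg_mem' := by
        intro a ha i
        simpa using ha i }
  have hJ : ∀ a ∈ J, ∀ b, 0 ≤ b → b ≤ a → b ∈ J := by
    intro a ha b hb hba i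
    obtain ⟨j, hj⟩ := ha i
    refine ⟨j, le_trans (add_le_add_right ?_ _) hj⟩
    rw [abs_of_nonneg hb]
    exact hba.trans (le_abs_self a)
  obtain ⟨L, _, _, _, p, hp, hsurj, hker⟩ := exists_convex_quotient J hJ
  have hpos : ∀ z : H, 0 < p z → ∃ i, ∀ j, ι (E j) < ι (E i) + z := by
    intro z hz
    have hz0 : 0 < z := by
      by_contra h
      exact not_le.2 hz (by simpa using hp (not_lt.1 h))
    have hzJ : z ∉ J := fun h => hz.ne' ((hker z).2 h)
    by_contra! hne
    refine hzJ fun i => ?_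
    obtain ⟨j, hj⟩ := hne i
    exact ⟨j, by rw [abs_of_pos hz0]; exact hj⟩
  refine ⟨L, inferInstance, inferInstance, inferInstance, p.comp ι, p ω, fun x y h => hp (hιle h),
    fun i => ?_, fun x y m n h => ?_, fun x y m n h => ?_, fun x hx => ?_, fun z hz => ?_⟩
  · refine lt_of_le_of_ne (hp (hω i).le) fun h => ?_
    have h0 : ω - ι (E i) ∈ J := by
      rw [← hker, map_sub, sub_eq_zero]
      exact h.symm
    obtain ⟨j, hj⟩ := h0 i
    rw [abs_of_pos (sub_pos.2 (hω i)), add_sub_cancel] at hj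
    exact not_lt.2 hj (hω j)
  · have h1 : ι x + m • ω < ι y + n • ω := by
      by_contra hle
      have := hp (not_lt.1 hle)
      simp only [map_add, map_nsmul] at this
      exact not_lt.2 this h
    exact hlt x y m n h1
  · simpa using hp (hle x y m n h)
  · obtain ⟨i, hi⟩ := hpos (ι x) hx
    refine ⟨i, fun j => sub_lt_iff_lt_add'.2 (hι.lt_iff_lt.1 ?_)⟩
    simpa using hi j
  · obtain ⟨ζ, rfl⟩ := hsurj z
    obtain ⟨i, hi⟩ := hpos ζ hz
    refine ⟨i, fun j => ?_⟩
    rw [sub_le_iff_le_add']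
    simpa using hp (hi j).le


/-! ### Two gauges -/

variable {Γ : Type*} [AddCommGroup Γ] [LinearOrder Γ] [IsOrderedAddMonoid Γ]
variable {Δ : Type u} [AddCommGroup Δ] [LinearOrder Δ] [IsOrderedAddMonoid Δ]
variable {τ : Γ →+ Δ} {D : Γ → Set Γ} {ΘD ΘU : Γ → Set Δ} {A : Set Γ} {d : Δ}

theorem SupportOp.map_mem_closure {L : Type*} [AddCommGroup L] {Θ : Γ → Set Δ} (h : SupportOp τ Θ)
    (π : Δ →+ L) {e : ℕ → Γ} {a : Γ} (ha : a ∈ AddSubgroup.closure (Set.range e)) {θ : Δ}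
    (hθ : θ ∈ Θ a) : π θ ∈ AddSubmonoid.closure (π '' ⋃ i, Θ (e i)) := by
  have : AddSubgroup.closure (Set.range e) ≤
      h.absorbed π (AddSubmonoid.closure (π '' ⋃ i, Θ (e i))) := by
    refine (AddSubgroup.closure_le _).2 ?_
    rintro _ ⟨i, rfl⟩ θ hθ
    exact AddSubmonoid.subset_closure ⟨θ, Set.mem_iUnion.2 ⟨i, hθ⟩, rfl⟩
  exact this ha θ hθ

/-- If the derivation increases exponents by at least `-e i` for some `i` at each step, and if
`τ (e i) < d` for all `i`, then supports of iterated derivatives admit no bad sequences. Values are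
measured in the limit of the sequence `τ (e i)`. -/
theorem not_antitone_of_strictMono_bound (hτ : StrictMono τ) (hD : SupportOp τ ΘD)
    (hU : SupportOp τ ΘU) (hDΘ : ∀ q, ∀ η ∈ D q, d + τ η ∈ ΘD q)
    (hR : ∀ k, {q | Reach D A q k}.IsPWO) {e : ℕ → Γ} (he : StrictMono e)
    (hed : ∀ i, τ (e i) < d) (hD0 : ∀ i, ∀ θ ∈ ΘD (e i), 0 ≤ θ) (hU0 : ∀ i, ∀ θ ∈ ΘU (e i), 0 ≤ θ)
    (hstep : ∀ q k η, Reach D A q k → η ∈ D q → ∃ i, 0 ≤ η + e i)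
    {q : ℕ → Γ} {k : ℕ → ℕ} {θ : ℕ → Δ} (hq : ∀ n, Reach D A (q n) (k n)) (hk : StrictMono k)
    (hθ : ∀ n, θ n ∈ ΘU (q n)) : ¬ Antitone fun n => τ (q n) + θ n + k n • d := by
  have hE : StrictMono fun i => τ (e i) := hτ.comp he
  obtain ⟨L, _, _, _, π, ε, hπ, hπε, hlt, hle, hC, hG⟩ := exists_limit hE
  have happ : ∀ {Θ : Γ → Set Δ}, SupportOp τ Θ → (∀ i, ∀ θ ∈ Θ (e i), 0 ≤ θ) →
      (AddSubmonoid.closure (π '' ⋃ i, Θ (e i)) : Set L).IsPWO := by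
    intro Θ h h0
    refine Set.IsPWO.addSubmonoid_closure ?_ (h.isPWO_of_cauchy hτ hπ he hC h0)
    rintro _ ⟨θ, hθ, rfl⟩
    obtain ⟨i, hi⟩ := Set.mem_iUnion.1 hθ
    simpa using hπ (h0 i θ hi)
  have hgauge : Gauge τ D ΘD ΘU A π ε := by
    refine ⟨hπ, fun q k η hq hη => ?_, AddSubgroup.closure (Set.range e), _, _, happ hD hD0,
      happ hU hU0, fun a ha θ hθ => hD.map_mem_closure π ha hθ,
      fun a ha θ hθ => hU.map_mem_closure π ha hθ, fun q k hk hv => ?_⟩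
    · obtain ⟨i, hi⟩ := hstep q k η hq hη
      have h1 := hπ (hτ.monotone hi)
      simp only [map_zero, map_add] at h1
      exact h1.trans_lt (add_lt_add_right (hπε i) _)
    have hmem : ∀ i, e i ∈ AddSubgroup.closure (Set.range e) := fun i =>
      AddSubgroup.subset_closure ⟨i, rfl⟩
    by_cases hgap : ∃ N, ∀ l ≥ N, π (τ (e (l + 1))) = π (τ (e l))
    · -- The sequence is eventually constant in the coarsening.
      obtain ⟨N, hN⟩ := hgap
      have hN' : ∀ l ≥ N, π (τ (e l)) = π (τ (e N)) := by
        intro l hl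
        induction l, hl using Nat.le_induction with
        | base => rfl
        | succ l hl ih => rw [hN l hl, ih]
      obtain ⟨φ, hφ, hφP⟩ := extraction_forall_of_frequently fun n =>
        (hlt _ _ _ _ (hv n.lt_succ_self)).and_eventually (eventually_ge_atTop N)
      refine ⟨fun n => k n • e (φ n), fun n => AddSubgroup.nsmul_mem _ (hmem _) _,
        monotone_nat_of_le_succ fun n => hτ.le_iff_le.1 ?_, fun m n hmn => ?_⟩
      · simp only [map_add, map_nsmul]
        refine (hφP n).1.le.trans (add_le_add_right (nsmul_le_nsmul_right ?_ _) _)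
        exact hE.monotone (hφ n.lt_succ_self).le
      · simp only [map_nsmul]
        rw [hN' _ (hφP m).2, hN' _ (hφP n).2, ← nsmul_sub, ← nsmul_sub]
        exact nsmul_lt_nsmul_left (sub_pos.2 (hπε N)) (hk hmn)
    · -- There are arbitrarily small gaps, which are used to correct the approximation.
      push Not at hgap
      have hgap1 : ∀ z : L, 0 < z → ∃ l, 0 < π (τ (e (l + 1)) - τ (e l)) ∧
          π (τ (e (l + 1)) - τ (e l)) < z := by
        intro z hz
        obtain ⟨i, hi⟩ := hG z hz
        obtain ⟨l, hl, hne⟩ := hgap i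
        obtain ⟨m, hm, hne'⟩ := hgap (l + 1)
        have hlt1 : ∀ {a b}, a ≤ b → π (τ (e a)) ≤ π (τ (e b)) := fun h => hπ (hE.monotone h)
        have h1 := (hlt1 l.le_succ).lt_of_ne hne.symm
        have h2 := (hlt1 m.le_succ).lt_of_ne hne'.symm
        refine ⟨l, by simpa using h1, ?_⟩
        rw [map_sub]
        calc _ ≤ π (τ (e m)) - π (τ (e i)) := sub_le_sub (hlt1 hm) (hlt1 hl)
          _ < π (τ (e (m + 1))) - π (τ (e i)) := sub_lt_sub_right h2 _
          _ ≤ z := hi _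
      have hgap2 : ∀ (n : ℕ) (z : L), 0 < z → ∃ l, 0 < π (τ (e (l + 1)) - τ (e l)) ∧
          π (τ (e (l + 1)) - τ (e l)) < z ∧ n • π (τ (e (l + 1)) - τ (e l)) < z := by
        intro n
        induction n with
        | zero =>
          intro z hz
          obtain ⟨l, h1, h2⟩ := hgap1 z hz
          exact ⟨l, h1, h2, by simpa using hz⟩
        | succ n ih =>
          intro z hz
          obtain ⟨a, ha1, ha2⟩ := hgap1 z hz
          obtain ⟨l, h1, h2, h3⟩ := ih _ (lt_min ha1 (sub_pos.2 ha2))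
          refine ⟨l, h1, (h2.trans_le (min_le_left _ _)).trans ha2, ?_⟩
          rw [succ_nsmul]
          calc _ < _ := add_lt_add (h3.trans_le (min_le_right _ _)) (h2.trans_le (min_le_left _ _))
            _ = z := sub_add_cancel _ _
      -- The correction at `n` is a gap which is smaller than the increase of the values at `n`. The
      -- index `φ n` is then chosen so large that the remaining error is smaller than this gap.
      choose l hl0 hl1 using fun n => hgap1 _ (sub_pos.2 (hv (Nat.lt_succ_self n)))
      have hev : ∀ n, ∀ᶠ j in atTop,
          k n • (ε - π (τ (e j))) < π (τ (e (l n + 1)) - τ (e (l n))) := by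
        intro n
        obtain ⟨m, hm1, -, hm2⟩ := hgap2 (k n) _ (hl0 n)
        obtain ⟨i, hi⟩ := hC _ hm1
        have h1 : ε - π (τ (e i)) ≤ π (τ (e (m + 1)) - τ (e m)) := by
          rw [sub_le_iff_le_add]
          have := hle 0 (τ (e (m + 1)) - τ (e m) + τ (e i)) 1 0 fun j => by
            simpa using sub_le_iff_le_add.1 (hi j).le
          simpa using this
        filter_upwards [eventually_ge_atTop i] with j hj
        refine lt_of_le_of_lt (nsmul_le_nsmul_right (le_trans ?_ h1) _) hm2
        exact sub_le_sub_left (hπ (hE.monotone hj)) _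
      obtain ⟨φ, hφ, hφP⟩ := extraction_forall_of_frequently fun n =>
        (hlt (τ (q n) + (τ (e (l n + 1)) - τ (e (l n)))) (τ (q (n + 1))) (k n) (k (n + 1)) (by
          have := add_lt_of_lt_sub_right (hl1 n)
          beta_reduce at this
          rw [map_add]
          calc _ = _ := by abel
            _ < _ := this)).and_eventually (hev n)
      have hr : ∀ n, (∑ i ∈ Finset.range n, (e (l i + 1) - e (l i))) ∈
          AddSubgroup.closure (Set.range e) := fun n =>
        sum_mem fun i _ => sub_mem (hmem _) (hmem _)
      refine ⟨fun n => k n • e (φ n) - ∑ i ∈ Finset.range n, (e (l i + 1) - e (l i)),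
        fun n => sub_mem (AddSubgroup.nsmul_mem _ (hmem _) _) (hr n),
        monotone_nat_of_le_succ fun n => hτ.le_iff_le.1 ?_, strictMono_nat_of_lt_succ fun n => ?_⟩
      · beta_reduce
        rw [Finset.sum_range_succ]
        set r := ∑ i ∈ Finset.range n, (e (l i + 1) - e (l i))
        simp only [map_add, map_sub, map_nsmul]
        have h1 : τ (q n) + (τ (e (l n + 1)) - τ (e (l n))) + k n • τ (e (φ n)) ≤
            τ (q (n + 1)) + k (n + 1) • τ (e (φ (n + 1))) :=
          (hφP n).1.le.trans (add_le_add_right (nsmul_le_nsmul_right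
            (hE.monotone (hφ n.lt_succ_self).le) _) _)
        calc _ = (τ (q n) + (τ (e (l n + 1)) - τ (e (l n))) + k n • τ (e (φ n))) +
              (-τ r - (τ (e (l n + 1)) - τ (e (l n)))) := by abel
          _ ≤ _ := add_le_add_left h1 _
          _ = _ := by abel
      · beta_reduce
        rw [Finset.sum_range_succ]
        set r := ∑ i ∈ Finset.range n, (e (l i + 1) - e (l i))
        have h1 := (hφP n).2
        have h2 : 0 ≤ k (n + 1) • (ε - π (τ (e (φ (n + 1))))) :=
          nsmul_nonneg (sub_nonneg.2 (hπε _).le) _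
        simp only [map_add, map_sub, map_nsmul, nsmul_sub] at h1 h2 ⊢
        calc _ = k n • ε - k n • π (τ (e (φ n))) + π (τ r) := by abel
          _ < π (τ (e (l n + 1))) - π (τ (e (l n))) + π (τ r) := add_lt_add_left h1 _
          _ ≤ (k (n + 1) • ε - k (n + 1) • π (τ (e (φ (n + 1))))) +
              (π (τ (e (l n + 1))) - π (τ (e (l n))) + π (τ r)) := le_add_of_nonneg_left h2
          _ = _ := by abel
  intro hanti
  refine not_antitone_of_gauge hτ.monotone hD hU hDΘ hR hgauge hq hk hθ fun m n hmn => ?_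
  obtain ⟨c, hc⟩ := Nat.exists_eq_add_of_le (hk.monotone hmn)
  refine hle _ _ _ _ fun j => ?_
  have h1 := hanti hmn
  have h2 : c • τ (e j) ≤ c • d := nsmul_le_nsmul_right (hed j).le _
  simp only [hc, add_nsmul] at h1 ⊢
  have h3 : τ (q n) + θ n + c • d ≤ τ (q m) + θ m := by
    refine le_of_add_le_add_right (a := k m • d) ?_
    calc _ = _ := by abel
      _ ≤ _ := h1
  calc _ = τ (q n) + θ n + c • τ (e j) + k m • τ (e j) := by abel
    _ ≤ _ := add_le_add_left ((add_le_add_right h2 _).trans h3) _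

/-- The analogue of `not_antitone_of_strictMono_bound` for a constant bound `-e`. Values are
measured by the exponent with `d` replaced by `τ e`, and ties are broken by the number of
derivations. -/
theorem not_antitone_of_const_bound (hτ : StrictMono τ) (hD : SupportOp τ ΘD)
    (hU : SupportOp τ ΘU) (hDΘ : ∀ q, ∀ η ∈ D q, d + τ η ∈ ΘD q)
    (hR : ∀ k, {q | Reach D A q k}.IsPWO) {e : Γ} (hed : τ e < d)
    (hDe : ∀ z : ℤ, ΘD (z • e) ⊆ insert 0 (ΘD e)) (hU0 : ∀ θ ∈ ΘU e, 0 ≤ θ)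
    (hstep : ∀ q k η, Reach D A q k → η ∈ D q → 0 ≤ η + e)
    {q : ℕ → Γ} {k : ℕ → ℕ} {θ : ℕ → Δ} (hq : ∀ n, Reach D A (q n) (k n)) (hk : StrictMono k)
    (hθ : ∀ n, θ n ∈ ΘU (q n)) : ¬ Antitone fun n => τ (q n) + θ n + k n • d := by
  let π : Δ →+ Δ ×ₗ ℤ :=
    { toFun := fun x => toLex (x, 0), map_zero' := rfl, map_add' := fun _ _ => rfl }
  have hπ : Monotone π := fun x y hxy => by
    rcases hxy.eq_or_lt with rfl | h
    · exact le_rfl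
    · exact (Prod.Lex.toLex_lt_toLex.2 (Or.inl h)).le
  let ε : Δ ×ₗ ℤ := toLex (τ e, 1)
  have hlin : ∀ (x : Δ) (m : ℕ), π x + m • ε = toLex (x + m • τ e, (m : ℤ)) := by
    intro x m
    have : m • ε = toLex (m • τ e, m • (1 : ℤ)) := rfl
    rw [this, nsmul_one]
    change toLex (x + m • τ e, 0 + (m : ℤ)) = _
    rw [zero_add]
  have hgauge : Gauge τ D ΘD ΘU A π ε := by
    refine ⟨hπ, fun q k η hq hη => ?_, AddSubgroup.zmultiples e, π '' insert 0 (ΘD e),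
      π '' AddSubmonoid.closure (ΘU e), ?_, ?_, ?_, ?_, fun q k hk hv => ?_⟩
    · have := hstep q k η hq hη
      have h1 := hτ.monotone this
      rw [map_zero, map_add] at h1
      have h2 := hlin (τ η) 1
      simp only [one_nsmul] at h2
      rw [h2]
      refine Prod.Lex.toLex_lt_toLex.2 ?_
      rcases h1.eq_or_lt with h | h
      · exact Or.inr ⟨h, by simp⟩
      · exact Or.inl h
    · exact ((hD.isPWO e).insert 0).image_of_monotone hπ
    · exact (Set.IsPWO.addSubmonoid_closure hU0 (hU.isPWO e)).image_of_monotone hπ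
    · rintro _ ⟨z, rfl⟩ θ hθ
      exact ⟨θ, hDe z hθ, rfl⟩
    · intro a ha θ hθ
      have : AddSubgroup.zmultiples e ≤
          hU.absorbed (AddMonoidHom.id Δ) (AddSubmonoid.closure (ΘU e)) :=
        AddSubgroup.zmultiples_le_of_mem fun θ hθ => AddSubmonoid.subset_closure hθ
      exact ⟨θ, this ha θ hθ, rfl⟩
    · refine ⟨fun n => k n • e, fun n => AddSubgroup.nsmul_mem _
        (AddSubgroup.mem_zmultiples e) _, fun m n hmn => hτ.le_iff_le.1 ?_, fun m n hmn => ?_⟩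
      · have := hv.monotone hmn
        simp only [hlin] at this
        simp only [map_add, map_nsmul]
        rcases Prod.Lex.toLex_le_toLex.1 this with h | h
        · exact h.le
        · exact h.1.le
      · have key : ∀ n, k n • ε - π (τ (k n • e)) = toLex (0, (k n : ℤ)) := by
          intro n
          rw [sub_eq_iff_eq_add, ← zero_add (k n • ε), ← map_zero π, hlin, map_nsmul, zero_add]
          change _ = toLex (0 + k n • τ e, (k n : ℤ) + 0)
          rw [zero_add, add_zero]
        simp only [key]
        exact Prod.Lex.toLex_lt_toLex.2 (Or.inr ⟨rfl, Nat.cast_lt.2 (hk hmn)⟩)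
  intro hanti
  refine not_antitone_of_gauge hτ.monotone hD hU hDΘ hR hgauge hq hk hθ
    (antitone_nat_of_succ_le fun n => ?_)
  rw [hlin, hlin]
  refine (Prod.Lex.toLex_lt_toLex.2 (Or.inl ?_)).le
  obtain ⟨c, hc⟩ := Nat.exists_eq_add_of_lt (hk n.lt_succ_self)
  have h1 := hanti n.le_succ
  have h2 : (c + 1) • τ e < (c + 1) • d := nsmul_lt_nsmul_right (Nat.succ_ne_zero c) hed
  simp only [Nat.succ_eq_add_one, hc, add_assoc (k n), add_nsmul _ (k n) (c + 1)] at h1 ⊢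
  have h3 : τ (q (n + 1)) + θ (n + 1) + (c + 1) • d ≤ τ (q n) + θ n := by
    refine le_of_add_le_add_right (a := k n • d) ?_
    calc _ = _ := by abel
      _ ≤ _ := h1
  calc _ = τ (q (n + 1)) + θ (n + 1) + (c + 1) • τ e + k n • τ e := by abel
    _ < _ := add_lt_add_left ((add_lt_add_right h2 _).trans_le h3) _

end

section

/-! ### Supports of inverses -/

section Inverse

variable {Γ K : Type*} [AddCommGroup Γ] [LinearOrder Γ] [IsOrderedAddMonoid Γ] [Field K]

/-- The support of `y⁻¹` relative to its order lies in every monoid of exponents which contains the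
support of `y` relative to its order. At the least exceptional exponent, the coefficient of the
product `y * y⁻¹` would not vanish. -/
theorem support_inv_add_order_subset {y : HahnSeries Γ K} (hy : y ≠ 0) {P : AddSubmonoid Γ}
    (hP : ∀ γ ∈ y.support, γ - y.order ∈ P) {γ : Γ} (hγ : γ ∈ (y⁻¹).support) :
    γ + y.order ∈ P := by
  by_contra hne
  have hwf : ((y⁻¹).support ∩ {γ | γ + y.order ∉ P}).IsWF :=
    (y⁻¹).isWF_support.mono Set.inter_subset_left
  have hnon : ((y⁻¹).support ∩ {γ | γ + y.order ∉ P}).Nonempty := ⟨γ, hγ, hne⟩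
  obtain ⟨hc, hcP⟩ := hwf.min_mem hnon
  set c := hwf.min hnon with hcdef
  have hmin : ∀ b ∈ (y⁻¹).support, b < c → b + y.order ∈ P := by
    intro b hb hbc
    by_contra h
    exact hwf.not_lt_min hnon ⟨hb, h⟩ hbc
  have hc0 : y.order + c ≠ 0 := by
    intro h
    exact hcP (by rw [add_comm, h]; exact P.zero_mem)
  have h1 : (y * y⁻¹).coeff (y.order + c) = 0 := by
    rw [mul_inv_cancel₀ hy]
    exact coeff_single_of_ne hc0
  have hyo : y.order ∈ y.support := by
    rw [mem_support]
    exact fun h => hy (coeff_order_eq_zero.1 h)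
  rw [coeff_mul, Finset.sum_eq_single (y.order, c)] at h1
  · exact mul_ne_zero hyo hc h1
  · rintro ⟨a, b⟩ hab hne
    exfalso
    rw [Finset.mem_antidiagonal] at hab
    obtain ⟨ha, hb, hab⟩ := hab
    simp only at ha hb hab
    have hle : y.order ≤ a := order_le_of_coeff_ne_zero ha
    rcases hle.eq_or_lt with rfl | hlt
    · exact hne (by rw [add_left_cancel hab])
    · have hbc : b < c := by
        by_contra h
        exact (add_lt_add_of_lt_of_le hlt (not_lt.1 h)).ne' hab
      refine hcP ?_
      have := P.add_mem (hP a ha) (hmin b hb hbc)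
      have e : c + y.order = a - y.order + (b + y.order) := by
        rw [add_comm c, ← hab]
        abel
      rwa [← e] at this
  · intro h
    refine absurd ?_ h
    rw [Finset.mem_antidiagonal]
    exact ⟨hyo, hc, rfl⟩

theorem leadingCoeff_eq_of_forall_le {a b : HahnSeries Γ K} (hb : b ≠ 0)
    (h : ∀ γ ≤ b.order, a.coeff γ = b.coeff γ) :
    a.leadingCoeff = b.leadingCoeff := by
  have h1 : a.coeff b.order ≠ 0 := by
    rw [h _ le_rfl]
    exact fun h => hb (coeff_order_eq_zero.1 h)
  have h2 : a.order = b.order := by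
    refine le_antisymm (order_le_of_coeff_ne_zero h1) (not_lt.1 fun hlt => ?_)
    have ha : a ≠ 0 := ne_zero_of_coeff_ne_zero h1
    refine ha (coeff_order_eq_zero.1 ?_)
    rw [h _ hlt.le]
    exact coeff_eq_zero_of_lt_order hlt
  rw [leadingCoeff_eq, leadingCoeff_eq, h2, h _ le_rfl]

end Inverse

/-! ### Arithmetic of series -/

variable {Γ Δ : Type u} {K : Type v}
variable [AddCommGroup Γ] [LinearOrder Γ] [IsOrderedAddMonoid Γ]
variable [AddCommGroup Δ] [LinearOrder Δ] [IsOrderedAddMonoid Δ]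
variable [Field K] {κ : Cardinal.{u}} [Fact (ℵ₀ < κ)]

theorem mem_supp {s : Series Γ K κ} {γ : Γ} : γ ∈ supp s ↔ s.1.coeff γ ≠ 0 := Iff.rfl

theorem coeff_smul_series (c : K) (s : Series Γ K κ) (γ : Γ) :
    (c • s).1.coeff γ = c * s.1.coeff γ := by
  rw [Algebra.smul_def]
  exact coeff_single_zero_mul

theorem supp_isPWO (s : Series Γ K κ) : (supp s).IsPWO := s.1.isPWO_support

theorem card_supp_lt (s : Series Γ K κ) : #(supp s) < κ := s.2

theorem supp_zero : supp (0 : Series Γ K κ) = ∅ := support_zero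

theorem supp_add_subset (s t : Series Γ K κ) : supp (s + t) ⊆ supp s ∪ supp t :=
  support_add_subset ..

theorem supp_neg (s : Series Γ K κ) : supp (-s) = supp s := support_neg

theorem supp_mul_subset {s t : Series Γ K κ} {γ : Γ} (h : γ ∈ supp (s * t)) :
    ∃ a ∈ supp s, ∃ b ∈ supp t, a + b = γ := Set.mem_add.1 (support_mul_subset h)

theorem supp_smul_subset (c : K) (s : Series Γ K κ) : supp (c • s) ⊆ supp s := by
  intro γ hγ
  rw [mem_supp, coeff_smul_series] at hγ
  exact right_ne_zero_of_mul hγ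

theorem supp_one_subset : supp (1 : Series Γ K κ) ⊆ {0} := support_single_subset

theorem coe_monomial (γ : Γ) : (monomial K κ γ).1 = single γ 1 := rfl

theorem monomial_ne_zero (γ : Γ) : monomial K κ γ ≠ 0 := fun h =>
  single_ne_zero (one_ne_zero (α := K)) (congrArg Subtype.val h)

theorem monomial_add (a b : Γ) : monomial K κ (a + b) = monomial K κ a * monomial K κ b := by
  refine Subtype.ext ?_
  change _ = single a 1 * single b 1
  rw [single_mul_single, mul_one]
  rfl

theorem monomial_zero : monomial K κ (0 : Γ) = 1 := rfl

theorem monomial_neg (a : Γ) : monomial K κ (-a) = (monomial K κ a)⁻¹ := by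
  refine eq_inv_of_mul_eq_one_left ?_
  rw [← monomial_add, neg_add_cancel, monomial_zero]

theorem term_eq_smul (γ : Γ) (c : K) : term κ γ c = c • monomial K κ γ := by
  refine Subtype.ext (HahnSeries.ext (funext fun η => ?_))
  rw [coeff_smul_series, coe_monomial]
  change (single γ c).coeff η = _
  rw [coeff_single, coeff_single]
  split_ifs <;> simp

theorem mem_supp_monomial {γ η : Γ} : η ∈ supp (monomial K κ γ) ↔ η = γ := by
  rw [mem_supp, coe_monomial, coeff_single]
  simp

theorem add_mem_supp_monomial_mul {γ η : Γ} {s : Series Γ K κ} :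
    γ + η ∈ supp (monomial K κ γ * s) ↔ η ∈ supp s := by
  rw [mem_supp, mem_supp, add_comm γ]
  change (single γ 1 * s.1).coeff _ ≠ 0 ↔ _
  rw [coeff_single_mul_add, one_mul]

theorem supp_inv_subset {G : AddSubgroup Γ} {s : Series Γ K κ} (hs : supp s ⊆ G) :
    supp s⁻¹ ⊆ G := by
  by_cases h0 : s = 0
  · rw [h0, inv_zero, supp_zero]
    exact Set.empty_subset _
  have h0' : s.1 ≠ 0 := fun h => h0 (Subtype.ext h)
  have ho : s.1.order ∈ G := hs (fun h => h0' (coeff_order_eq_zero.1 h))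
  intro γ hγ
  have := support_inv_add_order_subset h0' (P := G.toAddSubmonoid)
    (fun γ hγ => G.sub_mem (hs hγ) ho) (γ := γ) hγ
  have h2 := G.sub_mem this ho
  rwa [add_sub_cancel_right] at h2

/-! ### Summable families -/

section Summable

variable {I : Type*} {s s' : I → Series Γ K κ} {t t' : Series Γ K κ}

/-- A summable family of series, as a summable family of Hahn series. -/
def IsSummable.family (h : IsSummable s) : SummableFamily Γ K I where
  toFun i := (s i).1
  isPWO_iUnion_support' := h.isPWO
  finite_co_support' := h.finite

theorem hasFormalSum_iff : HasFormalSum s t ↔ ∃ h : IsSummable s, h.family.hsum = t.1 := by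
  constructor
  · rintro ⟨h, ht⟩
    exact ⟨h, HahnSeries.ext (funext fun γ => (ht γ).symm)⟩
  · rintro ⟨h, ht⟩
    exact ⟨h, fun γ => by rw [← ht]; rfl⟩

theorem IsSummable.exists_hasFormalSum (h : IsSummable s) : ∃ t, HasFormalSum s t := by
  refine ⟨⟨h.family.hsum, ?_⟩, hasFormalSum_iff.2 ⟨h, rfl⟩⟩
  exact (mk_le_mk_of_subset (SummableFamily.support_hsum_subset (s := h.family))).trans_lt h.card_lt

theorem HasFormalSum.unique (h : HasFormalSum s t) (h' : HasFormalSum s t') : t = t' :=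
  Subtype.ext (HahnSeries.ext (funext fun γ => (h.2 γ).trans (h'.2 γ).symm))

theorem HasFormalSum.supp_subset (h : HasFormalSum s t) : supp t ⊆ ⋃ i, supp (s i) := by
  obtain ⟨h, ht⟩ := hasFormalSum_iff.1 h
  have := SummableFamily.support_hsum_subset (s := h.family)
  rwa [ht] at this

theorem IsSummable.mono (h : IsSummable s) (hs : ∀ i, supp (s' i) ⊆ supp (s i)) :
    IsSummable s' where
  isPWO := h.isPWO.mono (Set.iUnion_mono hs)
  card_lt := (mk_le_mk_of_subset (Set.iUnion_mono hs)).trans_lt h.card_lt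
  finite γ := (h.finite γ).subset fun i hi => hs i hi

theorem IsSummable.comp_injective {J : Type*} {f : J → I} (h : IsSummable s)
    (hf : Function.Injective f) : IsSummable (s ∘ f) where
  isPWO := h.isPWO.mono (Set.iUnion_subset fun j => Set.subset_iUnion (fun i => supp (s i)) (f j))
  card_lt := (mk_le_mk_of_subset (Set.iUnion_subset fun j =>
    Set.subset_iUnion (fun i => supp (s i)) (f j))).trans_lt h.card_lt
  finite γ := Set.Finite.preimage (f := f) hf.injOn (h.finite γ)

theorem HasFormalSum.add (h : HasFormalSum s t) (h' : HasFormalSum s' t') :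
    HasFormalSum (fun i => s i + s' i) (t + t') := by
  refine ⟨⟨?_, ?_, fun γ => ?_⟩, fun γ => ?_⟩
  · refine (h.1.isPWO.union h'.1.isPWO).mono (Set.iUnion_subset fun i => ?_)
    exact (supp_add_subset _ _).trans (Set.union_subset_union
      (Set.subset_iUnion (fun i => supp (s i)) i) (Set.subset_iUnion (fun i => supp (s' i)) i))
  · have hκ : ℵ₀ ≤ κ := (Fact.out : ℵ₀ < κ).le
    refine lt_of_le_of_lt ((mk_le_mk_of_subset ?_).trans (mk_union_le _ _))
      (add_lt_of_lt hκ h.1.card_lt h'.1.card_lt)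
    exact Set.iUnion_subset fun i => (supp_add_subset _ _).trans (Set.union_subset_union
      (Set.subset_iUnion (fun i => supp (s i)) i) (Set.subset_iUnion (fun i => supp (s' i)) i))
  · exact ((h.1.finite γ).union (h'.1.finite γ)).subset fun i hi => supp_add_subset _ _ hi
  · have e : (t + t').1.coeff γ = t.1.coeff γ + t'.1.coeff γ := rfl
    rw [e, h.2, h'.2]
    exact (finsum_add_distrib (h.1.finite γ) (h'.1.finite γ)).symm

theorem HasFormalSum.const_mul (h : HasFormalSum s t) (c : Series Γ K κ) :
    HasFormalSum (fun i => c * s i) (c * t) := by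
  obtain ⟨h, ht⟩ := hasFormalSum_iff.1 h
  have hκ : ℵ₀ ≤ κ := (Fact.out : ℵ₀ < κ).le
  refine hasFormalSum_iff.2 ⟨⟨(c.1 • h.family).isPWO_iUnion_support, ?_,
    (c.1 • h.family).finite_co_support⟩, ?_⟩
  · refine lt_of_le_of_lt ((mk_le_mk_of_subset ?_).trans mk_add_le)
      (mul_lt_of_lt hκ (card_supp_lt c) h.card_lt)
    refine Set.iUnion_subset fun i γ hγ => ?_
    obtain ⟨a, ha, b, hb, hab⟩ := supp_mul_subset hγ
    exact ⟨a, ha, b, Set.mem_iUnion.2 ⟨i, hb⟩, hab⟩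
  · change _ = c.1 * t.1
    rw [← ht, ← SummableFamily.hsum_smul]
    rfl

theorem HasFormalSum.const_smul (h : HasFormalSum s t) (c : K) :
    HasFormalSum (fun i => c • s i) (c • t) := by
  simp only [Algebra.smul_def]
  exact h.const_mul _

/-- Every series is the sum of its terms. -/
theorem hasFormalSum_terms (s : Series Γ K κ) :
    HasFormalSum (fun γ : Γ => s.1.coeff γ • monomial K κ γ) s := by
  have hs : ∀ γ : Γ, supp (s.1.coeff γ • monomial K κ γ) ⊆ supp s ∩ {γ} := by
    intro γ η hη
    have h1 := mem_supp_monomial.1 (supp_smul_subset _ _ hη)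
    subst h1
    rw [mem_supp, coeff_smul_series] at hη
    exact ⟨left_ne_zero_of_mul hη, rfl⟩
  refine ⟨⟨(supp_isPWO s).mono (Set.iUnion_subset fun γ => (hs γ).trans Set.inter_subset_left),
    (mk_le_mk_of_subset (Set.iUnion_subset fun γ =>
      (hs γ).trans Set.inter_subset_left)).trans_lt (card_supp_lt s),
    fun γ => (Set.finite_singleton γ).subset fun η hη => (hs η hη).2.symm⟩, fun γ => ?_⟩
  rw [finsum_eq_single _ γ]
  · rw [coeff_smul_series, coe_monomial, coeff_single_same, mul_one]
  · intro η hη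
    rw [coeff_smul_series, coe_monomial, coeff_single_of_ne hη.symm, mul_zero]

theorem isSummable_monomial {A : Set Γ} (hA : A.IsPWO) (hκ : #A < κ) :
    IsSummable fun γ : A => monomial K κ (γ : Γ) := by
  have hs : (⋃ γ : A, supp (monomial K κ (γ : Γ))) ⊆ A := by
    refine Set.iUnion_subset fun γ η hη => ?_
    rw [mem_supp_monomial.1 hη]
    exact γ.2
  exact ⟨hA.mono hs, (mk_le_mk_of_subset hs).trans_lt hκ, fun γ =>
    Set.Subsingleton.finite fun a ha b hb => Subtype.ext
      ((mem_supp_monomial.1 ha).symm.trans (mem_supp_monomial.1 hb))⟩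

end Summable

/-! ### Strongly linear maps -/

section StronglyLinear

variable {Φ : Series Γ K κ →ₗ[K] Series Δ K κ}

theorem IsStronglyLinear.supp_subset (hΦ : IsStronglyLinear Φ) (s : Series Γ K κ) :
    supp (Φ s) ⊆ ⋃ γ ∈ supp s, supp (Φ (monomial K κ γ)) := by
  intro δ hδ
  obtain ⟨γ, hγ⟩ := Set.mem_iUnion.1 ((hΦ _ _ _ (hasFormalSum_terms s)).supp_subset hδ)
  rw [map_smul, mem_supp, coeff_smul_series] at hγ
  exact Set.mem_biUnion (left_ne_zero_of_mul hγ) (right_ne_zero_of_mul hγ)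

theorem IsStronglyLinear.isSummable_monomial (hΦ : IsStronglyLinear Φ) {A : Set Γ} (hA : A.IsPWO)
    (hκ : #A < κ) : IsSummable fun γ : A => Φ (monomial K κ (γ : Γ)) := by
  obtain ⟨t, ht⟩ := (HahnTaylor.isSummable_monomial (K := K) hA hκ).exists_hasFormalSum
  exact (hΦ _ _ _ ht).1

theorem IsStronglyLinear.isPWO_biUnion (hΦ : IsStronglyLinear Φ) {A : Set Γ} (hA : A.IsPWO)
    (hκ : #A < κ) : (⋃ γ ∈ A, supp (Φ (monomial K κ γ))).IsPWO := by
  rw [Set.biUnion_eq_iUnion]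
  exact (hΦ.isSummable_monomial hA hκ).isPWO

theorem IsStronglyLinear.card_biUnion_lt (hΦ : IsStronglyLinear Φ) {A : Set Γ} (hA : A.IsPWO)
    (hκ : #A < κ) : #(⋃ γ ∈ A, supp (Φ (monomial K κ γ)) : Set Δ) < κ := by
  rw [Set.biUnion_eq_iUnion]
  exact (hΦ.isSummable_monomial hA hκ).card_lt

theorem isPWO_range_of_monotone {a : ℕ → Γ} (ha : Monotone a) : (Set.range a).IsPWO := by
  rw [← Set.image_univ]
  exact (Set.IsPWO.of_linearOrder (α := ℕ) Set.univ).image_of_monotone ha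

theorem card_range_lt (a : ℕ → Γ) : #(Set.range a) < κ :=
  (le_aleph0_iff_set_countable.2 (Set.countable_range a)).trans_lt Fact.out

theorem IsStronglyLinear.isPWO_iUnion_of_monotone (hΦ : IsStronglyLinear Φ) {a : ℕ → Γ}
    (ha : Monotone a) : (⋃ n, supp (Φ (monomial K κ (a n)))).IsPWO := by
  have := hΦ.isPWO_biUnion (isPWO_range_of_monotone ha) (card_range_lt a)
  rwa [Set.biUnion_range] at this

end StronglyLinear

end

section

variable {Γ Δ : Type u} {K : Type v}
variable [AddCommGroup Γ] [LinearOrder Γ] [IsOrderedAddMonoid Γ]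
variable [AddCommGroup Δ] [LinearOrder Δ] [IsOrderedAddMonoid Δ]
variable [Field K] {κ : Cardinal.{u}} [Fact (ℵ₀ < κ)]

theorem coe_ne_zero {s : Series Γ K κ} (hs : s ≠ 0) : s.1 ≠ 0 := fun h => hs (Subtype.ext h)

theorem order_mem_supp {s : Series Γ K κ} (hs : s ≠ 0) : s.1.order ∈ supp s := fun h =>
  coe_ne_zero hs (coeff_order_eq_zero.1 h)

theorem order_le_of_mem_supp {s : Series Γ K κ} {γ : Γ} (hγ : γ ∈ supp s) : s.1.order ≤ γ :=
  order_le_of_coeff_ne_zero hγ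

theorem orderTop_eq_order {s : Series Γ K κ} (hs : s ≠ 0) : s.1.orderTop = s.1.order :=
  (order_eq_orderTop_of_ne_zero (coe_ne_zero hs)).symm

theorem ne_zero_of_mem_supp {s : Series Γ K κ} {γ : Γ} (hγ : γ ∈ supp s) : s ≠ 0 := by
  rintro rfl
  rw [supp_zero] at hγ
  exact hγ

theorem orderTop_le_of_mem_supp {s : Series Γ K κ} {γ : Γ} (hγ : γ ∈ supp s) :
    s.1.orderTop ≤ γ := orderTop_le_of_coeff_ne_zero hγ

theorem orderTop_inv {s : Series Γ K κ} (hs : s ≠ 0) :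
    (s⁻¹).1.orderTop = ((-s.1.order : Γ) : WithTop Γ) := by
  have h1 : s * s⁻¹ = 1 := mul_inv_cancel₀ hs
  have h2 : s⁻¹ ≠ 0 := inv_ne_zero hs
  rw [orderTop_eq_order h2, WithTop.coe_inj]
  refine eq_neg_of_add_eq_zero_right ?_
  rw [← order_mul (coe_ne_zero hs) (coe_ne_zero h2)]
  exact (congrArg (fun s : Series Γ K κ => s.1.order) h1).trans order_one

/-! ### The action of a morphism on exponents -/

section Tri

variable (tri : Series Γ K κ →ₐ[K] Series Δ K κ)

theorem map_monomial_ne_zero (γ : Γ) : tri (monomial K κ γ) ≠ 0 :=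
  (map_ne_zero tri).2 (monomial_ne_zero γ)

/-- The map which sends the exponent `γ` to the order of the image of `t ^ γ`. -/
def valueHom : Γ →+ Δ where
  toFun γ := (tri (monomial K κ γ)).1.order
  map_zero' := by
    rw [monomial_zero, map_one]
    exact order_one
  map_add' a b := by
    rw [monomial_add, map_mul]
    exact order_mul (coe_ne_zero (map_monomial_ne_zero tri a))
      (coe_ne_zero (map_monomial_ne_zero tri b))

/-- The support of the image of `t ^ γ`, relative to its order. -/
def relSupp (γ : Γ) : Set Δ := {θ | valueHom tri γ + θ ∈ supp (tri (monomial K κ γ))}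

variable {tri}

theorem valueHom_le_of_mem_supp {γ : Γ} {ω : Δ} (hω : ω ∈ supp (tri (monomial K κ γ))) :
    valueHom tri γ ≤ ω := order_le_of_mem_supp hω

theorem nonneg_of_mem_relSupp {γ : Γ} {θ : Δ} (hθ : θ ∈ relSupp tri γ) : 0 ≤ θ :=
  nonneg_of_le_add_right (valueHom_le_of_mem_supp hθ)

theorem supportOp_relSupp (htri : IsStronglyLinear tri.toLinearMap) :
    SupportOp (valueHom tri) (relSupp tri) where
  zero := by
    intro θ hθ
    unfold relSupp at hθ
    rw [Set.mem_ofPred_eq, monomial_zero, map_one, map_zero, zero_add] at hθ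
    exact supp_one_subset hθ
  add := by
    intro a b θ hθ
    unfold relSupp at hθ
    rw [Set.mem_ofPred_eq, monomial_add, map_mul] at hθ
    obtain ⟨α, hα, β, hβ, h⟩ := supp_mul_subset hθ
    refine ⟨α - valueHom tri a, ?_, β - valueHom tri b, ?_, ?_⟩
    · unfold relSupp
      rwa [Set.mem_ofPred_eq, add_sub_cancel]
    · unfold relSupp
      rwa [Set.mem_ofPred_eq, add_sub_cancel]
    · rw [sub_add_sub_comm, h, map_add, add_sub_cancel_left]
  neg := by
    intro a θ hθ
    unfold relSupp at hθ
    rw [Set.mem_ofPred_eq, monomial_neg, map_inv₀] at hθ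
    have h0 := coe_ne_zero (map_monomial_ne_zero tri a)
    have := support_inv_add_order_subset h0 (P := AddSubmonoid.closure (relSupp tri a))
      (fun ω hω => AddSubmonoid.subset_closure (by
        change valueHom tri a + (ω - valueHom tri a) ∈ supp (tri (monomial K κ a))
        rwa [add_sub_cancel])) hθ
    change valueHom tri (-a) + θ + valueHom tri a ∈ AddSubmonoid.closure (relSupp tri a) at this
    rwa [map_neg, neg_add_eq_sub, sub_add_cancel] at this
  pwo := by
    intro a ha
    refine (htri.isPWO_iUnion_of_monotone ha).mono ?_
    refine Set.iUnion_mono fun n => ?_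
    rintro _ ⟨θ, hθ, rfl⟩
    exact hθ

section Order

variable [LinearOrder K] [IsStrictOrderedRing K]

theorem less_smul_monomial {γ η : Γ} (h : γ < η) (c : K) :
    Less (c • monomial K κ η) (monomial K κ γ) := by
  unfold Less
  have h1 : ((monomial K κ γ - c • monomial K κ η : Series Γ K κ)).1 =
      single γ 1 - single η c := by
    rw [← term_eq_smul]
    rfl
  change 0 < (monomial K κ γ - c • monomial K κ η : Series Γ K κ).1.leadingCoeff
  have h2 : (single γ (1 : K)).orderTop < (single η c).orderTop := by
    rw [orderTop_single one_ne_zero]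
    exact lt_orderTop_single h
  rw [h1, leadingCoeff_sub h2, leadingCoeff_of_single]
  exact one_pos

/-- The relation `t ^ η ≺ t ^ γ` means that `c t ^ η < t ^ γ` for all constants `c`, and these
inequalities are preserved by a morphism of ordered rings. -/
theorem valueHom_strictMono
    (htri_lt : ∀ s t : Series Γ K κ, Less s t → Less (tri s) (tri t)) :
    StrictMono (valueHom tri) := by
  intro γ η hγη
  by_contra hle
  rw [not_lt] at hle
  set τ := valueHom tri
  set b := (tri (monomial K κ η)).1.coeff (τ η) with hb
  set a := (tri (monomial K κ γ)).1.coeff (τ η) with ha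
  have hb0 : b ≠ 0 := order_mem_supp (map_monomial_ne_zero tri η)
  -- The multiple of `t ^ η` is chosen so that the difference has leading coefficient `-1`.
  have h1 := htri_lt _ _ (less_smul_monomial hγη ((a + 1) / b))
  unfold Less at h1
  rw [map_smul] at h1
  set u := tri (monomial K κ γ) - ((a + 1) / b) • tri (monomial K κ η) with hu
  have hcoeff : ∀ ω, u.1.coeff ω = (tri (monomial K κ γ)).1.coeff ω -
      (a + 1) / b * (tri (monomial K κ η)).1.coeff ω := by
    intro ω
    rw [← coeff_smul_series]
    rfl
  have h2 : u.1.coeff (τ η) = -1 := by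
    rw [hcoeff, ← hb, ← ha, div_mul_cancel₀ _ hb0]
    ring
  have h3 : u.1.order = τ η := by
    refine le_antisymm (order_le_of_coeff_ne_zero (by rw [h2]; simp)) ?_
    have hu0 : u ≠ 0 := ne_zero_of_mem_supp (γ := τ η) (by rw [mem_supp, h2]; simp)
    by_contra hlt
    rw [not_le] at hlt
    refine order_mem_supp hu0 ?_
    rw [hcoeff, coeff_eq_zero_of_lt_order (hlt.trans_le hle), coeff_eq_zero_of_lt_order hlt]
    simp
  change 0 < u.1.leadingCoeff at h1
  rw [leadingCoeff_eq, h3, h2] at h1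
  linarith

end Order

theorem le_of_mem_supp_map (htri : IsStronglyLinear tri.toLinearMap)
    (hτ : StrictMono (valueHom tri)) {s : Series Γ K κ} {ω : Δ} (hω : ω ∈ supp (tri s)) :
    valueHom tri s.1.order ≤ ω := by
  obtain ⟨γ, hγ, h⟩ := Set.mem_iUnion₂.1 (htri.supp_subset s hω)
  exact (hτ.monotone (order_le_of_mem_supp hγ)).trans (valueHom_le_of_mem_supp h)

/-- The order of an image is determined by the dominant term, since the images of the other terms
have larger orders. -/
theorem order_map (htri : IsStronglyLinear tri.toLinearMap) (hτ : StrictMono (valueHom tri))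
    {s : Series Γ K κ} (hs : s ≠ 0) : (tri s).1.order = valueHom tri s.1.order := by
  refine le_antisymm (order_le_of_coeff_ne_zero ?_)
    (le_of_mem_supp_map htri hτ (order_mem_supp ((map_ne_zero tri).2 hs)))
  have h1 := (htri _ _ _ (hasFormalSum_terms s)).2 (valueHom tri s.1.order)
  rw [finsum_eq_single _ s.1.order] at h1
  · change (tri s).1.coeff _ = (tri (_ • _)).1.coeff _ at h1
    rw [h1, map_smul, coeff_smul_series]
    exact mul_ne_zero (order_mem_supp hs) (order_mem_supp (map_monomial_ne_zero tri _))
  · intro γ hγ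
    change (tri (_ • _)).1.coeff _ = 0
    rw [map_smul, coeff_smul_series]
    by_cases h : s.1.coeff γ = 0
    · rw [h, zero_mul]
    · have hlt : s.1.order < γ := (order_le_of_coeff_ne_zero h).lt_of_ne hγ.symm
      rw [coeff_eq_zero_of_lt_order (hτ hlt), mul_zero]

end Tri

/-! ### Logarithmic derivatives of monomials -/

section Der

variable (der : Derivation K (Series Γ K κ) (Series Γ K κ))

/-- The logarithmic derivative of monomials, as a homomorphism. -/
def logDerHom : Γ →+ Series Γ K κ where
  toFun γ := logDer der (monomial K κ γ)
  map_zero' := by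
    unfold logDer
    rw [monomial_zero, Derivation.map_one_eq_zero, zero_div]
  map_add' a b := by
    unfold logDer
    have ha := monomial_ne_zero (K := K) (κ := κ) a
    have hb := monomial_ne_zero (K := K) (κ := κ) b
    rw [monomial_add, Derivation.leibniz, smul_eq_mul, smul_eq_mul, div_add_div _ _ ha hb]
    ring

/-- The support of the logarithmic derivative of `t ^ γ`. -/
def logDerSupp (γ : Γ) : Set Γ := supp (logDerHom der γ)

variable {der}

theorem add_mem_supp_der {γ η : Γ} :
    γ + η ∈ supp (der (monomial K κ γ)) ↔ η ∈ logDerSupp der γ := by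
  have : der (monomial K κ γ) = monomial K κ γ * logDerHom der γ :=
    (mul_div_cancel₀ _ (monomial_ne_zero γ)).symm
  rw [this, add_mem_supp_monomial_mul]
  rfl

/-- The supports of logarithmic derivatives of monomials, shifted by the exponent of `δ`. -/
def shiftedSupp (der : Derivation K (Series Γ K κ) (Series Γ K κ)) (τ : Γ →+ Δ) (d : Δ) (γ : Γ) :
    Set Δ := insert 0 ((fun η => d + τ η) '' logDerSupp der γ)

/-- Logarithmic derivatives are additive, so the shifted supports obey the calculus of relative
supports. The element `0` makes the sum of the sets for `a` and `b` contain both of them. -/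
theorem supportOp_shiftedSupp
    (hder : IsStronglyLinear (der : Series Γ K κ →ₗ[K] Series Γ K κ)) {τ : Γ →+ Δ}
    (hτ : StrictMono τ) (d : Δ) : SupportOp τ (shiftedSupp der τ d) where
  zero := by
    rintro θ (rfl | ⟨η, hη, rfl⟩)
    · rfl
    · unfold logDerSupp at hη
      rw [map_zero, supp_zero] at hη
      exact hη.elim
  add := by
    rintro a b θ (rfl | ⟨η, hη, rfl⟩)
    · exact ⟨0, Or.inl rfl, 0, Or.inl rfl, add_zero 0⟩
    · unfold logDerSupp at hη
      rw [map_add] at hη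
      rcases supp_add_subset _ _ hη with h | h
      · exact ⟨_, Or.inr ⟨η, h, rfl⟩, 0, Or.inl rfl, add_zero _⟩
      · exact ⟨0, Or.inl rfl, _, Or.inr ⟨η, h, rfl⟩, zero_add _⟩
  neg := by
    intro a
    refine subset_trans (le_of_eq ?_) AddSubmonoid.subset_closure
    unfold shiftedSupp logDerSupp
    rw [map_neg, supp_neg]
  pwo := by
    intro a ha
    have h1 : (Set.range fun n => τ (a n)).IsPWO :=
      isPWO_range_of_monotone (hτ.monotone.comp ha)
    have h2 := (hder.isPWO_iUnion_of_monotone ha).image_of_monotone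
      (f := fun γ => d + τ γ) fun x y hxy => add_le_add_right (hτ.monotone hxy) d
    refine (h1.union h2).mono (Set.iUnion_subset fun n => ?_)
    rintro _ ⟨θ, rfl | ⟨η, hη, rfl⟩, rfl⟩
    · exact Or.inl ⟨n, (add_zero _).symm⟩
    · refine Or.inr ⟨a n + η, Set.mem_iUnion.2 ⟨n, add_mem_supp_der.2 hη⟩, ?_⟩
      simp only [map_add]
      abel

theorem reach_succ_subset {A : Set Γ} {k : ℕ} : {q | Reach (logDerSupp der) A q (k + 1)} ⊆
    ⋃ q ∈ {q | Reach (logDerSupp der) A q k}, supp (der (monomial K κ q)) := by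
  intro q hq
  cases hq with
  | step h hη => exact Set.mem_biUnion (by exact h) (add_mem_supp_der.2 hη)

theorem reach_zero_subset {A : Set Γ} : {q | Reach (logDerSupp der) A q 0} ⊆ A := by
  intro q hq
  cases hq with
  | base h => exact h

/-- By strong linearity, the exponents which are reached in `k` steps are well-ordered; the bound
for their number serves to apply strong linearity again. -/
theorem isPWO_reach (hder : IsStronglyLinear (der : Series Γ K κ →ₗ[K] Series Γ K κ)) {A : Set Γ}
    (hA : A.IsPWO) (hκ : #A < κ) (k : ℕ) : {q | Reach (logDerSupp der) A q k}.IsPWO := by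
  suffices {q | Reach (logDerSupp der) A q k}.IsPWO ∧
      #{q | Reach (logDerSupp der) A q k} < κ from this.1
  induction k with
  | zero => exact ⟨hA.mono reach_zero_subset, (mk_le_mk_of_subset reach_zero_subset).trans_lt hκ⟩
  | succ k ih =>
    exact ⟨(hder.isPWO_biUnion ih.1 ih.2).mono reach_succ_subset,
      (mk_le_mk_of_subset reach_succ_subset).trans_lt (hder.card_biUnion_lt ih.1 ih.2)⟩

theorem supp_iterate_der_subset (hder : IsStronglyLinear (der : Series Γ K κ →ₗ[K] Series Γ K κ))
    {A : Set Γ} {s : Series Γ K κ} (hs : supp s ⊆ A) (k : ℕ) :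
    supp (der^[k] s) ⊆ {q | Reach (logDerSupp der) A q k} := by
  induction k with
  | zero => exact fun q hq => Reach.base (hs hq)
  | succ k ih =>
    intro q hq
    rw [Function.iterate_succ_apply'] at hq
    obtain ⟨γ, hγ, h⟩ := Set.mem_iUnion₂.1 (hder.supp_subset _ hq)
    have := Reach.step (ih hγ) (add_mem_supp_der.1 ((add_sub_cancel γ q).symm ▸ h))
    rwa [add_sub_cancel] at this

theorem Reach.exists_singleton {D : Γ → Set Γ} {A : Set Γ} {q : Γ} {k : ℕ} (h : Reach D A q k) :
    ∃ m ∈ A, Reach D {m} q k := by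
  induction h with
  | base h => exact ⟨_, h, Reach.base rfl⟩
  | step _ hη ih =>
    obtain ⟨m, hm, h⟩ := ih
    exact ⟨m, hm, h.step hη⟩

theorem Reach.mono {D : Γ → Set Γ} {A B : Set Γ} (hAB : A ⊆ B) {q : Γ} {k : ℕ}
    (h : Reach D A q k) : Reach D B q k := by
  induction h with
  | base h => exact Reach.base (hAB h)
  | step _ hη ih => exact ih.step hη

end Der

end

section

variable {Γ Δ : Type u} {K : Type v}
variable [AddCommGroup Γ] [LinearOrder Γ] [IsOrderedAddMonoid Γ]
variable [AddCommGroup Δ] [LinearOrder Δ] [IsOrderedAddMonoid Δ]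
variable [Field K] {κ : Cardinal.{u}} [Fact (ℵ₀ < κ)]
variable {der : Derivation K (Series Γ K κ) (Series Γ K κ)} {tri : Series Γ K κ →ₐ[K] Series Δ K κ}
variable {x : Series Γ K κ} {δ : Series Δ K κ}

/-! ### The monomials of the Taylor domain -/

theorem le_orderTop_iff_supp {s : Series Γ K κ} {a : Γ} :
    (a : WithTop Γ) ≤ s.1.orderTop ↔ ∀ η ∈ supp s, a ≤ η := by
  constructor
  · exact fun h η hη => WithTop.coe_le_coe.1 (h.trans (orderTop_le_of_mem_supp hη))
  · intro h
    by_cases hs : s = 0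
    · rw [hs]
      exact le_of_le_of_eq le_top orderTop_zero.symm
    · rw [orderTop_eq_order hs]
      exact WithTop.coe_le_coe.2 (h _ (order_mem_supp hs))

theorem mem_taylorMonomials (htri : IsStronglyLinear tri.toLinearMap)
    (hτ : StrictMono (valueHom tri)) (hδ : δ ≠ 0) {γ : Γ} :
    γ ∈ taylorMonomials der tri δ ↔
      ∀ η ∈ logDerSupp der γ, 0 < valueHom tri η + δ.1.order := by
  have h1 : γ ∈ taylorMonomials der tri δ ↔
      0 < (tri (logDerHom der γ) * δ).1.orderTop := by
    change (1 : HahnSeries Δ K).orderTop < _ ↔ _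
    rw [orderTop_one]
    rfl
  rw [h1]
  by_cases h0 : logDerHom der γ = 0
  · unfold logDerSupp
    rw [h0, map_zero, zero_mul, supp_zero]
    refine iff_of_true ?_ fun η hη => hη.elim
    change 0 < (0 : HahnSeries Δ K).orderTop
    rw [orderTop_zero]
    exact WithTop.coe_lt_top 0
  · have h2 := (map_ne_zero tri).2 h0
    rw [orderTop_eq_order (mul_ne_zero h2 hδ)]
    have h3 : (tri (logDerHom der γ) * δ).1.order =
        valueHom tri (logDerHom der γ).1.order + δ.1.order := by
      rw [← order_map htri hτ h0]
      exact order_mul (coe_ne_zero h2) (coe_ne_zero hδ)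
    rw [h3, WithTop.coe_pos]
    refine ⟨fun h η hη => h.trans_le (add_le_add_left (hτ.monotone (order_le_of_mem_supp hη)) _),
      fun h => h _ (order_mem_supp h0)⟩

theorem valueHom_order_lt (htri : IsStronglyLinear tri.toLinearMap)
    (hτ : StrictMono (valueHom tri)) (hx : x ≠ 0) (hδ : StrictlyDominated δ (tri x)) (hδ0 : δ ≠ 0) :
    valueHom tri x.1.order < δ.1.order := by
  unfold StrictlyDominated at hδ
  rw [orderTop_eq_order hδ0, orderTop_eq_order ((map_ne_zero tri).2 hx), WithTop.coe_lt_coe,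
    order_map htri hτ hx] at hδ
  exact hδ

/-- The exponents `γ` for which `(t ^ γ)† ≼ x⁻¹`. -/
def tameExponents (der : Derivation K (Series Γ K κ) (Series Γ K κ)) (x : Series Γ K κ) : Set Γ :=
  {γ | Dominated (logDerHom der γ) x⁻¹}

theorem mem_tameExponents (hx : x ≠ 0) {γ : Γ} :
    γ ∈ tameExponents der x ↔ ∀ η ∈ logDerSupp der γ, -x.1.order ≤ η := by
  unfold tameExponents Dominated
  rw [Set.mem_ofPred_eq, orderTop_inv hx, le_orderTop_iff_supp]
  rfl

theorem DerivativeDichotomy.add_mem_tameExponents (hdich : DerivativeDichotomy der x) {γ η : Γ}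
    (hγ : γ ∈ tameExponents der x) (hη : η ∈ logDerSupp der γ) : γ + η ∈ tameExponents der x := by
  rcases hdich γ with h | h
  · exact h.2 _ (add_mem_supp_der.2 hη)
  · exact absurd h.1 (not_lt.2 hγ)

theorem DerivativeDichotomy.orderTop_eq (hdich : DerivativeDichotomy der x) {γ η : Γ}
    (hγ : γ ∉ tameExponents der x) (hη : η ∈ logDerSupp der γ) :
    (logDerHom der (γ + η)).1.orderTop = (logDerHom der γ).1.orderTop := by
  rcases hdich γ with h | h
  · exact absurd h.1 hγ
  · have := h.2 _ (add_mem_supp_der.2 hη)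
    exact le_antisymm this.2 this.1

theorem DerivativeDichotomy.reach_tame (hdich : DerivativeDichotomy der x) {A : Set Γ}
    (hA : A ⊆ tameExponents der x) {q : Γ} {k : ℕ} (h : Reach (logDerSupp der) A q k) :
    q ∈ tameExponents der x := by
  induction h with
  | base h => exact hA h
  | step _ hη ih => exact hdich.add_mem_tameExponents ih hη

theorem DerivativeDichotomy.reach_orderTop_eq (hdich : DerivativeDichotomy der x) {m : Γ}
    (hm : m ∉ tameExponents der x) {q : Γ} {k : ℕ} (h : Reach (logDerSupp der) {m} q k) :
    (logDerHom der q).1.orderTop = (logDerHom der m).1.orderTop := by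
  induction h with
  | base h => rw [h]
  | step _ hη ih =>
    rw [← ih]
    refine hdich.orderTop_eq (fun h => hm ?_) hη
    unfold tameExponents Dominated at h ⊢
    rwa [Set.mem_ofPred_eq, ih] at h

theorem logDerHom_ne_zero_of_not_tame {γ : Γ} (hγ : γ ∉ tameExponents der x) :
    logDerHom der γ ≠ 0 := by
  intro h
  refine hγ ?_
  change _ ≤ (logDerHom der γ).1.orderTop
  rw [h]
  exact le_of_le_of_eq le_top orderTop_zero.symm

/-- The Taylor domain is closed under derivation. -/
theorem add_mem_taylorMonomials (htri : IsStronglyLinear tri.toLinearMap)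
    (hτ : StrictMono (valueHom tri)) (hdich : DerivativeDichotomy der x) (hx : x ≠ 0)
    (hδ : StrictlyDominated δ (tri x)) {γ η : Γ} (hγ : γ ∈ taylorMonomials der tri δ)
    (hη : η ∈ logDerSupp der γ) : γ + η ∈ taylorMonomials der tri δ := by
  by_cases hδ0 : δ = 0
  · unfold taylorMonomials StrictlyDominated
    rw [hδ0, Set.mem_ofPred_eq, mul_zero]
    change (1 : HahnSeries Δ K).orderTop < (0 : HahnSeries Δ K).orderTop
    rw [orderTop_one, orderTop_zero]
    exact WithTop.coe_lt_top 0
  rw [mem_taylorMonomials htri hτ hδ0] at hγ ⊢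
  intro η' hη'
  by_cases ht : γ ∈ tameExponents der x
  · have h1 := (mem_tameExponents hx).1 (hdich.add_mem_tameExponents ht hη) η' hη'
    have h2 := hτ.monotone h1
    rw [map_neg] at h2
    exact (lt_neg_add_iff_add_lt.2 (by simpa using valueHom_order_lt htri hτ hx hδ hδ0)).trans_le
      (add_le_add_left h2 _)
  · have h0 := logDerHom_ne_zero_of_not_tame ht
    have h1 := hdich.orderTop_eq ht hη
    rw [orderTop_eq_order h0] at h1
    have h2 := le_orderTop_iff_supp.1 h1.ge η' hη'
    exact (hγ _ (order_mem_supp h0)).trans_le (add_le_add_left (hτ.monotone h2) _)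

theorem reach_mem_taylorMonomials (htri : IsStronglyLinear tri.toLinearMap)
    (hτ : StrictMono (valueHom tri)) (hdich : DerivativeDichotomy der x) (hx : x ≠ 0)
    (hδ : StrictlyDominated δ (tri x)) {A : Set Γ} (hA : A ⊆ taylorMonomials der tri δ) {q : Γ}
    {k : ℕ} (h : Reach (logDerSupp der) A q k) : q ∈ taylorMonomials der tri δ := by
  induction h with
  | base h => exact hA h
  | step _ hη ih => exact add_mem_taylorMonomials htri hτ hdich hx hδ ih hη

/-- Taylor terms of positive degree are below the term of degree zero. -/
theorem valueHom_le_reach (htri : IsStronglyLinear tri.toLinearMap)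
    (hτ : StrictMono (valueHom tri)) (hdich : DerivativeDichotomy der x) (hx : x ≠ 0)
    (hδ : StrictlyDominated δ (tri x)) (hδ0 : δ ≠ 0) {A : Set Γ}
    (hA : A ⊆ taylorMonomials der tri δ) {a : Γ} (ha : ∀ m ∈ A, a ≤ m) {q : Γ} {k : ℕ}
    (h : Reach (logDerSupp der) A q k) :
    valueHom tri a ≤ valueHom tri q + k • δ.1.order ∧
      (k ≠ 0 → valueHom tri a < valueHom tri q + k • δ.1.order) := by
  induction h with
  | base h => simpa using hτ.monotone (ha _ h)
  | @step q η k h hη ih =>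
    have h1 := reach_mem_taylorMonomials htri hτ hdich hx hδ hA h
    rw [mem_taylorMonomials htri hτ hδ0] at h1
    have h2 : valueHom tri a < valueHom tri (q + η) + (k + 1) • δ.1.order := by
      rw [map_add, succ_nsmul]
      calc _ ≤ _ := ih.1
        _ < valueHom tri q + k • δ.1.order + (valueHom tri η + δ.1.order) :=
          lt_add_of_pos_right _ (h1 η hη)
        _ = _ := by abel
    exact ⟨h2.le, fun _ => h2⟩

/-! ### Absence of bad sequences -/

section Bad

variable {A : Set Γ}

theorem shiftedSupp_zsmul_subset (τ : Γ →+ Δ) (d : Δ) (e : Γ) (z : ℤ) :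
    shiftedSupp der τ d (z • e) ⊆ insert 0 (shiftedSupp der τ d e) := by
  rintro θ (rfl | ⟨η, hη, rfl⟩)
  · exact Or.inl rfl
  · refine Or.inr (Or.inr ⟨η, ?_, rfl⟩)
    unfold logDerSupp at hη
    rw [map_zsmul, ← Int.cast_smul_eq_zsmul K] at hη
    exact supp_smul_subset _ _ hη

/-- The case of a constant bound for the logarithmic derivatives. -/
theorem not_antitone_of_le (hder : IsStronglyLinear (der : Series Γ K κ →ₗ[K] Series Γ K κ))
    (htri : IsStronglyLinear tri.toLinearMap) (hτ : StrictMono (valueHom tri)) (hA : A.IsPWO)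
    (hκ : #A < κ) {e : Γ} {d : Δ} (hed : valueHom tri e < d)
    (hstep : ∀ q k η, Reach (logDerSupp der) A q k → η ∈ logDerSupp der q → -e ≤ η)
    {q : ℕ → Γ} {k : ℕ → ℕ} {θ : ℕ → Δ} (hq : ∀ n, Reach (logDerSupp der) A (q n) (k n))
    (hk : StrictMono k) (hθ : ∀ n, θ n ∈ relSupp tri (q n)) :
    ¬ Antitone fun n => valueHom tri (q n) + θ n + k n • d :=
  not_antitone_of_const_bound hτ (supportOp_shiftedSupp hder hτ d) (supportOp_relSupp htri)
    (fun _ η hη => Or.inr ⟨η, hη, rfl⟩) (isPWO_reach hder hA hκ) hed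
    (shiftedSupp_zsmul_subset _ _ _) (fun _ => nonneg_of_mem_relSupp)
    (fun q k η h hη => neg_le_iff_add_nonneg.1 (hstep q k η h hη)) hq hk hθ

/-- The values of the terms `t ^ ω δ ^ k`, where `t ^ ω` ranges over the terms of the `k`-th
derivatives of monomials of a Noetherian subset of the Taylor domain, admit no nonincreasing
sequence with increasing `k`. By the dichotomy, one of three cases occurs on a subsequence:
the logarithmic derivatives are bounded by `x⁻¹`; or their dominant monomials are preserved by
derivation, and are either bounded by the first of them or strictly increasing. -/
theorem not_antitone_reach (hder : IsStronglyLinear (der : Series Γ K κ →ₗ[K] Series Γ K κ))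
    (htri : IsStronglyLinear tri.toLinearMap) (hτ : StrictMono (valueHom tri))
    (hdich : DerivativeDichotomy der x) (hx : x ≠ 0) (hδ : StrictlyDominated δ (tri x))
    (hδ0 : δ ≠ 0) (hA : A.IsPWO) (hκ : #A < κ) (hAM : A ⊆ taylorMonomials der tri δ)
    {q : ℕ → Γ} {k : ℕ → ℕ} {θ : ℕ → Δ} (hq : ∀ n, Reach (logDerSupp der) A (q n) (k n))
    (hk : StrictMono k) (hθ : ∀ n, θ n ∈ relSupp tri (q n)) :
    ¬ Antitone fun n => valueHom tri (q n) + θ n + k n • δ.1.order := by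
  intro hanti
  choose m hmA hmq using fun n => (hq n).exists_singleton
  have hsub : ∀ {B : Set Γ}, B ⊆ A → B.IsPWO ∧ #B < κ := fun h =>
    ⟨hA.mono h, (mk_le_mk_of_subset h).trans_lt hκ⟩
  obtain ⟨φ, hφ⟩ : ∃ φ : ℕ ↪o ℕ, (∀ n, m (φ n) ∈ tameExponents der x) ∨
      ∀ n, m (φ n) ∉ tameExponents der x :=
    Nat.exists_subseq_of_forall_mem_union (t := (tameExponents der x)ᶜ) m fun n => em _
  rcases hφ with hφ | hφ
  · -- The tame case: all steps are bounded by the order of `x`.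
    have hB := hsub (B := A ∩ tameExponents der x) Set.inter_subset_left
    refine not_antitone_of_le hder htri hτ hB.1 hB.2 (valueHom_order_lt htri hτ hx hδ hδ0)
      (fun q k η h hη => ?_) (q := q ∘ φ) (k := k ∘ φ) (θ := θ ∘ φ) (fun n => ?_)
      (hk.comp φ.strictMono) (fun n => hθ _) (hanti.comp_monotone φ.monotone)
    · exact (mem_tameExponents hx).1 (hdich.reach_tame Set.inter_subset_right h) η hη
    · exact (hmq (φ n)).mono (B := A ∩ _) (Set.singleton_subset_iff.2 ⟨hmA _, hφ n⟩)
  have hc0 := fun n => logDerHom_ne_zero_of_not_tame (hφ n)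
  set c : ℕ → Γ := fun n => (logDerHom der (m (φ n))).1.order with hc
  have hcmem : ∀ n, c n ∈ logDerSupp der (m (φ n)) := fun n => order_mem_supp (hc0 n)
  have hcd : ∀ n, 0 < valueHom tri (c n) + δ.1.order := fun n =>
    (mem_taylorMonomials htri hτ hδ0).1 (hAM (hmA (φ n))) _ (hcmem n)
  have hcd' : ∀ n, valueHom tri (-c n) < δ.1.order := fun n => by
    rw [map_neg, neg_lt_iff_pos_add']
    exact hcd n
  have hstep : ∀ n q k η, Reach (logDerSupp der) {m (φ n)} q k → η ∈ logDerSupp der q →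
      c n ≤ η := by
    intro n q k η h hη
    have h1 := hdich.reach_orderTop_eq (hφ n) h
    rw [orderTop_eq_order (hc0 n)] at h1
    exact le_orderTop_iff_supp.1 h1.ge η hη
  obtain ⟨ψ, hψ | hψ⟩ := exists_strictAnti_or_monotone_subseq c
  · -- The dominant exponents of the logarithmic derivatives decrease.
    have hB := hsub (B := Set.range fun n => m (φ (ψ n))) (by
      rintro _ ⟨n, rfl⟩
      exact hmA _)
    refine not_antitone_of_strictMono_bound (e := fun n => -c (ψ n)) hτ
      (supportOp_shiftedSupp hder hτ δ.1.order) (supportOp_relSupp htri)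
      (fun _ η hη => Or.inr ⟨η, hη, rfl⟩) (isPWO_reach hder hB.1 hB.2)
      (fun a b hab => neg_lt_neg (hψ hab)) (fun n => hcd' _) ?_
      (fun _ _ => nonneg_of_mem_relSupp) ?_ (q := fun n => q (φ (ψ n)))
      (k := fun n => k (φ (ψ n))) (θ := fun n => θ (φ (ψ n)))
      (fun n => (hmq _).mono (B := Set.range fun n => m (φ (ψ n)))
        (Set.singleton_subset_iff.2 ⟨n, rfl⟩))
      ((hk.comp φ.strictMono).comp ψ.strictMono) (fun n => hθ _)
      ((hanti.comp_monotone φ.monotone).comp_monotone ψ.monotone)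
    · -- By the dichotomy, the dominant monomials of the logarithmic derivatives have themselves
      -- small logarithmic derivatives.
      rintro i θ (rfl | ⟨η, hη, rfl⟩)
      · exact le_rfl
      set n := ψ i
      have h1 : (logDerHom der (c n)).1.orderTop ≥ (c n : WithTop Γ) := by
        have e : logDerHom der (c n) = logDerHom der (m (φ n) + c n) - logDerHom der (m (φ n)) := by
          rw [map_add, add_sub_cancel_left]
        have h2 := hdich.orderTop_eq (hφ n) (hcmem n)
        have h3 := orderTop_eq_order (hc0 n)
        rw [e]
        refine le_trans ?_ (min_orderTop_le_orderTop_sub (x := (logDerHom der (m (φ n) + c n)).1)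
          (y := (logDerHom der (m (φ n))).1))
        rw [h2, min_self, h3]
      unfold logDerSupp at hη
      rw [map_neg, supp_neg] at hη
      have h4 := hτ.monotone (le_orderTop_iff_supp.1 h1 η hη)
      change 0 ≤ δ.1.order + valueHom tri η
      rw [add_comm]
      exact (hcd n).le.trans (add_le_add_left h4 _)
    · intro q k η h hη
      obtain ⟨_, ⟨i, rfl⟩, h⟩ := h.exists_singleton
      exact ⟨i, by simpa using hstep _ _ _ _ h hη⟩
  · -- The dominant exponents of the logarithmic derivatives are bounded below by the first one.
    have hB := hsub (B := Set.range fun n => m (φ (ψ n))) (by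
      rintro _ ⟨n, rfl⟩
      exact hmA _)
    refine not_antitone_of_le hder htri hτ hB.1 hB.2 (hcd' (ψ 0))
      (fun q k η h hη => ?_) (q := fun n => q (φ (ψ n)))
      (k := fun n => k (φ (ψ n))) (θ := fun n => θ (φ (ψ n)))
      (fun n => (hmq _).mono (B := Set.range fun n => m (φ (ψ n)))
        (Set.singleton_subset_iff.2 ⟨n, rfl⟩))
      ((hk.comp φ.strictMono).comp ψ.strictMono) (fun n => hθ _)
      ((hanti.comp_monotone φ.monotone).comp_monotone ψ.monotone)
    obtain ⟨_, ⟨i, rfl⟩, h⟩ := h.exists_singleton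
    rw [neg_neg]
    exact (hψ (Nat.zero_le i)).trans (hstep _ _ _ _ h hη)

end Bad

end

section

variable {Γ Δ : Type u} {K : Type v}
variable [AddCommGroup Γ] [LinearOrder Γ] [IsOrderedAddMonoid Γ]
variable [AddCommGroup Δ] [LinearOrder Δ] [IsOrderedAddMonoid Δ]
variable [Field K] {κ : Cardinal.{u}} [Fact (ℵ₀ < κ)]

/-! ### Double sums -/

/-- A double sum may be computed as an iterated sum. -/
theorem HasFormalSum.of_prod {I J : Type*} {f : I × J → Series Γ K κ} {a : I → Series Γ K κ}
    {c : Series Γ K κ} (hf : HasFormalSum f c) (ha : ∀ i, HasFormalSum (fun j => f (i, j)) (a i)) :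
    HasFormalSum a c := by
  have hsub : (⋃ i, supp (a i)) ⊆ ⋃ p, supp (f p) := by
    refine Set.iUnion_subset fun i γ hγ => ?_
    obtain ⟨j, hj⟩ := Set.mem_iUnion.1 ((ha i).supp_subset hγ)
    exact Set.mem_iUnion.2 ⟨(i, j), hj⟩
  refine ⟨⟨hf.1.isPWO.mono hsub, (mk_le_mk_of_subset hsub).trans_lt hf.1.card_lt, fun γ => ?_⟩,
    fun γ => ?_⟩
  · refine ((hf.1.finite γ).image Prod.fst).subset fun i hi => ?_
    obtain ⟨j, hj⟩ := Set.mem_iUnion.1 ((ha i).supp_subset hi)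
    exact ⟨(i, j), hj, rfl⟩
  · rw [hf.2, finsum_curry _ (hf.1.finite γ)]
    exact finsum_congr fun i => ((ha i).2 γ).symm

theorem HasFormalSum.comp_equiv {I J : Type*} {f : I → Series Γ K κ} {c : Series Γ K κ}
    (hf : HasFormalSum f c) (e : J ≃ I) : HasFormalSum (f ∘ e) c :=
  ⟨hf.1.comp_injective e.injective, fun γ => by
    rw [hf.2, ← finsum_comp_equiv e]
    rfl⟩

theorem HasFormalSum.mul {I J : Type*} {f : I → Series Γ K κ} {g : J → Series Γ K κ}
    {a b : Series Γ K κ} (hf : HasFormalSum f a) (hg : HasFormalSum g b) :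
    HasFormalSum (fun p : I × J => f p.1 * g p.2) (a * b) := by
  obtain ⟨hf, ha⟩ := hasFormalSum_iff.1 hf
  obtain ⟨hg, hb⟩ := hasFormalSum_iff.1 hg
  have hκ : ℵ₀ ≤ κ := (Fact.out : ℵ₀ < κ).le
  refine hasFormalSum_iff.2 ⟨⟨(hf.family.mul hg.family).isPWO_iUnion_support, ?_,
    (hf.family.mul hg.family).finite_co_support⟩, ?_⟩
  · refine lt_of_le_of_lt ((mk_le_mk_of_subset ?_).trans mk_add_le)
      (mul_lt_of_lt hκ hf.card_lt hg.card_lt)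
    refine Set.iUnion_subset fun p γ hγ => ?_
    obtain ⟨a, ha, b, hb, hab⟩ := supp_mul_subset hγ
    exact ⟨a, Set.mem_iUnion.2 ⟨_, ha⟩, b, Set.mem_iUnion.2 ⟨_, hb⟩, hab⟩
  · change _ = a.1 * b.1
    rw [← ha, ← hb, ← SummableFamily.hsum_mul]
    rfl

theorem finsum_sum_antidiagonal {M : Type*} [AddCommMonoid M] (g : ℕ × ℕ → M)
    (hg : (Function.support g).Finite) :
    ∑ᶠ n, ∑ p ∈ Finset.HasAntidiagonal.antidiagonal n, g p = ∑ᶠ p, g p := by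
  classical
  have h1 : (Function.support fun n => ∑ p ∈ Finset.HasAntidiagonal.antidiagonal n, g p) ⊆
      (hg.toFinset.image fun p => p.1 + p.2 : Finset ℕ) := by
    intro n hn
    obtain ⟨p, hp, h⟩ := Finset.exists_ne_zero_of_sum_ne_zero hn
    simp only [Finset.coe_image, Set.mem_image]
    exact ⟨p, hg.mem_toFinset.2 h, Finset.HasAntidiagonal.mem_antidiagonal.1 hp⟩
  rw [finsum_eq_sum_of_support_subset g (s := hg.toFinset) (by simp),
    finsum_eq_sum_of_support_subset _ h1]
  refine Eq.trans (Finset.sum_congr rfl fun n _ => ?_) (Finset.sum_fiberwise_of_maps_to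
    (g := fun p : ℕ × ℕ => p.1 + p.2) (fun p hp => Finset.mem_image_of_mem _ hp) g)
  refine (Finset.sum_subset (fun p hp => ?_) fun p hp hp' => ?_).symm
  · exact Finset.HasAntidiagonal.mem_antidiagonal.2 (Finset.mem_filter.1 hp).2
  · by_contra h
    exact hp' (Finset.mem_filter.2 ⟨hg.mem_toFinset.2 h,
      Finset.HasAntidiagonal.mem_antidiagonal.1 hp⟩)

/-- A double sum over `ℕ × ℕ` may be computed along antidiagonals. -/
theorem HasFormalSum.antidiagonal {f : ℕ × ℕ → Series Γ K κ} {g : ℕ → Series Γ K κ}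
    {c c' : Series Γ K κ} (hf : HasFormalSum f c) (hg : HasFormalSum g c')
    (h : ∀ n, g n = ∑ p ∈ Finset.HasAntidiagonal.antidiagonal n, f p) : c' = c := by
  refine Subtype.ext (HahnSeries.ext (funext fun γ => ?_))
  rw [hg.2, hf.2, ← finsum_sum_antidiagonal _ (hf.1.finite γ)]
  refine finsum_congr fun n => ?_
  rw [h]
  let φ : Series Γ K κ →+ K :=
    { toFun := fun s => s.1.coeff γ, map_zero' := rfl, map_add' := fun _ _ => rfl }
  exact map_sum φ _ _

/-! ### Subfields of series with restricted supports -/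

/-- The field of series with supports in a given group of exponents. -/
def supportedIn (K : Type v) [Field K] (κ : Cardinal.{u}) [Fact (ℵ₀ < κ)] (G : AddSubgroup Γ) :
    IntermediateField K (Series Γ K κ) where
  carrier := {s | supp s ⊆ G}
  zero_mem' := by
    rw [Set.mem_ofPred_eq, supp_zero]
    exact Set.empty_subset _
  one_mem' := supp_one_subset.trans (Set.singleton_subset_iff.2 G.zero_mem)
  add_mem' := fun ha hb => (supp_add_subset _ _).trans (Set.union_subset ha hb)
  mul_mem' := by
    intro a b ha hb γ hγ
    obtain ⟨α, hα, β, hβ, rfl⟩ := supp_mul_subset hγ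
    exact G.add_mem (ha hα) (hb hβ)
  algebraMap_mem' := fun _ => support_single_subset.trans (Set.singleton_subset_iff.2 G.zero_mem)
  inv_mem' := fun _ h => supp_inv_subset h

variable {der : Derivation K (Series Γ K κ) (Series Γ K κ)} {tri : Series Γ K κ →ₐ[K] Series Δ K κ}
variable {x : Series Γ K κ} {δ : Series Δ K κ}

/-- The exponents in `taylorMonomials` form a group, since logarithmic derivatives are additive. -/
def taylorSubgroup (der : Derivation K (Series Γ K κ) (Series Γ K κ))
    (tri : Series Γ K κ →ₐ[K] Series Δ K κ) (δ : Series Δ K κ) : AddSubgroup Γ where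
  carrier := taylorMonomials der tri δ
  zero_mem' := by
    change (1 : HahnSeries Δ K).orderTop < (tri (logDerHom der 0) * δ).1.orderTop
    rw [map_zero, map_zero, zero_mul, orderTop_one]
    exact lt_of_lt_of_eq (WithTop.coe_lt_top 0) orderTop_zero.symm
  add_mem' := by
    intro a b ha hb
    change _ < (tri (logDerHom der (a + b)) * δ).1.orderTop
    rw [map_add, map_add, add_mul]
    exact (lt_min ha hb).trans_le (min_orderTop_le_orderTop_add
      (x := (tri (logDerHom der a) * δ).1) (y := (tri (logDerHom der b) * δ).1))
  neg_mem' := by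
    intro a ha
    change _ < (tri (logDerHom der (-a)) * δ).1.orderTop
    rw [map_neg, map_neg, neg_mul]
    exact lt_of_lt_of_eq ha (orderTop_neg (x := (tri (logDerHom der a) * δ).1)).symm

/-! ### Taylor terms -/

theorem iterate_der_mul (k : ℕ) (a b : Series Γ K κ) :
    der^[k] (a * b) =
      ∑ ij ∈ Finset.HasAntidiagonal.antidiagonal k,
        k.choose ij.1 • (der^[ij.1] a * der^[ij.2] b) := by
  induction k with
  | zero => simp
  | succ k ih =>
    rw [Finset.sum_antidiagonal_choose_succ_nsmul (fun i j => der^[i] a * der^[j] b) k,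
      Function.iterate_succ_apply', ih, map_sum, ← Finset.sum_add_distrib]
    refine Finset.sum_congr rfl fun ij hij => ?_
    have h : k.choose ij.2 = k.choose ij.1 := by
      rw [← Finset.HasAntidiagonal.mem_antidiagonal.1 hij, Nat.choose_symm_add]
    rw [h, ← nsmul_add, map_nsmul, Derivation.leibniz, smul_eq_mul, smul_eq_mul,
      Function.iterate_succ_apply', Function.iterate_succ_apply']
    ring

theorem taylorTerm_eq (s : Series Γ K κ) (k : ℕ) :
    taylorTerm der tri δ s k = (k.factorial : K)⁻¹ • (tri (der^[k] s) * δ ^ k) := by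
  unfold taylorTerm
  rw [Algebra.smul_def, map_inv₀, map_natCast, div_eq_mul_inv]
  ring

theorem taylorTerm_zero (s : Series Γ K κ) : taylorTerm der tri δ s 0 = tri s := by
  simp [taylorTerm]

theorem taylorTerm_one_succ (k : ℕ) : taylorTerm der tri δ 1 (k + 1) = 0 := by
  simp [taylorTerm]

theorem iterate_der_add (a b : Series Γ K κ) (k : ℕ) :
    der^[k] (a + b) = der^[k] a + der^[k] b :=
  iterate_map_add der k a b

theorem iterate_der_smul (c : K) (a : Series Γ K κ) (k : ℕ) :
    der^[k] (c • a) = c • der^[k] a := by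
  induction k with
  | zero => rfl
  | succ k ih =>
    rw [Function.iterate_succ_apply', ih, Function.iterate_succ_apply', Derivation.map_smul]

theorem taylorTerm_add (a b : Series Γ K κ) (k : ℕ) :
    taylorTerm der tri δ (a + b) k = taylorTerm der tri δ a k + taylorTerm der tri δ b k := by
  rw [taylorTerm_eq, taylorTerm_eq, taylorTerm_eq, iterate_der_add, map_add, add_mul, smul_add]

theorem taylorTerm_smul (c : K) (a : Series Γ K κ) (k : ℕ) :
    taylorTerm der tri δ (c • a) k = c • taylorTerm der tri δ a k := by
  rw [taylorTerm_eq, taylorTerm_eq, iterate_der_smul, map_smul, smul_mul_assoc, smul_comm]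

theorem taylorTerm_mul [CharZero K] (a b : Series Γ K κ) (k : ℕ) :
    taylorTerm der tri δ (a * b) k = ∑ ij ∈ Finset.HasAntidiagonal.antidiagonal k,
      taylorTerm der tri δ a ij.1 * taylorTerm der tri δ b ij.2 := by
  rw [taylorTerm_eq, iterate_der_mul, map_sum, Finset.sum_mul, Finset.smul_sum]
  refine Finset.sum_congr rfl fun ij hij => ?_
  rw [taylorTerm_eq, taylorTerm_eq, map_nsmul, map_mul, smul_mul_smul_comm, smul_mul_assoc,
    ← Nat.cast_smul_eq_nsmul K, smul_smul]
  have h := Finset.HasAntidiagonal.mem_antidiagonal.1 hij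
  congr 1
  · have h1 : ((k.factorial : ℕ) : K) ≠ 0 := Nat.cast_ne_zero.2 k.factorial_ne_zero
    have h2 : ((ij.1.factorial : ℕ) : K) ≠ 0 := Nat.cast_ne_zero.2 ij.1.factorial_ne_zero
    have h3 : ((ij.2.factorial : ℕ) : K) ≠ 0 := Nat.cast_ne_zero.2 ij.2.factorial_ne_zero
    have h4 : ((k.choose ij.1 : ℕ) : K) * ij.1.factorial * ij.2.factorial = k.factorial := by
      rw [← h]
      have := Nat.choose_mul_factorial_mul_factorial (Nat.le_add_right ij.1 ij.2)
      rw [Nat.add_sub_cancel_left] at this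
      exact_mod_cast this
    rw [← h4]
    have h5 : ((k.choose ij.1 : ℕ) : K) ≠ 0 := by
      intro h5
      rw [h5, zero_mul, zero_mul] at h4
      exact h1 h4.symm
    field_simp
  · rw [← h, _root_.pow_add]
    ring

theorem exists_of_mem_supp_taylorTerm {s : Series Γ K κ} {k : ℕ} {ω : Δ}
    (h : ω ∈ supp (taylorTerm der tri δ s k)) :
    ∃ a ∈ supp (tri (der^[k] s)), ∃ b ∈ supp (δ ^ k), a + b = ω := by
  rw [taylorTerm_eq] at h
  exact supp_mul_subset (supp_smul_subset _ _ h)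

theorem sub_mem_closure_of_mem_supp_pow {k : ℕ} {ω : Δ} (h : ω ∈ supp (δ ^ k)) :
    ω - k • δ.1.order ∈ AddSubmonoid.closure ((fun ω => ω - δ.1.order) '' supp δ) := by
  induction k generalizing ω with
  | zero =>
    rw [pow_zero] at h
    rw [supp_one_subset h, zero_nsmul, sub_zero]
    exact AddSubmonoid.zero_mem _
  | succ k ih =>
    rw [pow_succ] at h
    obtain ⟨a, ha, b, hb, rfl⟩ := supp_mul_subset h
    rw [succ_nsmul, add_sub_add_comm]
    exact AddSubmonoid.add_mem _ (ih ha) (AddSubmonoid.subset_closure ⟨b, hb, rfl⟩)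

theorem hasFormalSum_taylorTerm_apply
    (hder : IsStronglyLinear (der : Series Γ K κ →ₗ[K] Series Γ K κ))
    (htri : IsStronglyLinear tri.toLinearMap) {I : Type u} {s : I → Series Γ K κ}
    {t : Series Γ K κ} (h : HasFormalSum s t) (k : ℕ) :
    HasFormalSum (fun i => taylorTerm der tri δ (s i) k) (taylorTerm der tri δ t k) := by
  have h1 : HasFormalSum (fun i => der^[k] (s i)) (der^[k] t) := by
    induction k with
    | zero => exact h
    | succ k ih =>
      simp only [Function.iterate_succ_apply']
      exact hder _ _ _ ih
  have h2 := ((htri _ _ _ h1).const_mul (δ ^ k)).const_smul (k.factorial : K)⁻¹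
  simp only [taylorTerm_eq, mul_comm _ (δ ^ k)]
  exact h2

end

section

variable {Γ Δ : Type u} {K : Type v}
variable [AddCommGroup Γ] [LinearOrder Γ] [IsOrderedAddMonoid Γ]
variable [AddCommGroup Δ] [LinearOrder Δ] [IsOrderedAddMonoid Δ]
variable [Field K] {κ : Cardinal.{u}} [Fact (ℵ₀ < κ)]
variable {der : Derivation K (Series Γ K κ) (Series Γ K κ)} {tri : Series Γ K κ →ₐ[K] Series Δ K κ}
variable {x : Series Γ K κ} {δ : Series Δ K κ}

/-! ### Summability of Taylor series -/

/-- The exponents in the Taylor terms of a summable family admit no nonincreasing sequence whose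
members belong to terms of strictly increasing degrees. -/
theorem not_antitone_taylorTerm (hder : IsStronglyLinear (der : Series Γ K κ →ₗ[K] Series Γ K κ))
    (htri : IsStronglyLinear tri.toLinearMap) (hτ : StrictMono (valueHom tri))
    (hdich : DerivativeDichotomy der x) (hx : x ≠ 0) (hδ : StrictlyDominated δ (tri x))
    {I : Type*} {s : I → Series Γ K κ} (hs : IsSummable s)
    (hsM : ∀ i, supp (s i) ⊆ taylorMonomials der tri δ) {i : ℕ → I} {k : ℕ → ℕ} (hk : StrictMono k)
    {w : ℕ → Δ} (hw : ∀ n, w n ∈ supp (taylorTerm der tri δ (s (i n)) (k n))) : ¬ Antitone w := by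
  intro hanti
  choose a ha b hb hab using fun n => exists_of_mem_supp_taylorTerm (hw n)
  have hδ0 : δ ≠ 0 := by
    rintro rfl
    have h1 := hb 1
    rw [zero_pow (hk Nat.zero_lt_one).ne_bot, supp_zero] at h1
    exact h1
  set A := ⋃ i, supp (s i)
  have hq : ∀ n, ∃ q, Reach (logDerSupp der) A q (k n) ∧ a n - valueHom tri q ∈ relSupp tri q := by
    intro n
    obtain ⟨q, hq, h⟩ := Set.mem_iUnion₂.1 (htri.supp_subset _ (ha n))
    refine ⟨q, supp_iterate_der_subset hder
      (Set.subset_iUnion (fun i => supp (s i)) (i n)) _ hq, ?_⟩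
    unfold relSupp
    rwa [Set.mem_ofPred_eq, add_sub_cancel]
  choose q hq hθ using hq
  -- The contributions of the nonleading terms of `δ` are monotone on a subsequence.
  have hC : (AddSubmonoid.closure ((fun ω => ω - δ.1.order) '' supp δ) : Set Δ).IsPWO := by
    refine Set.IsPWO.addSubmonoid_closure ?_ ((supp_isPWO δ).image_of_monotone
      fun a b hab => sub_le_sub_right hab _)
    rintro _ ⟨ω, hω, rfl⟩
    exact sub_nonneg.2 (order_le_of_mem_supp hω)
  obtain ⟨φ, hφ⟩ := hC.exists_monotone_subseq (f := fun n => b n - k n • δ.1.order)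
    fun n => sub_mem_closure_of_mem_supp_pow (hb n)
  refine not_antitone_reach hder htri hτ hdich hx hδ hδ0 hs.isPWO hs.card_lt
    (Set.iUnion_subset hsM) (fun n => hq (φ n)) (hk.comp φ.strictMono) (fun n => hθ (φ n))
    fun m n hmn => ?_
  have h1 := hanti (φ.monotone hmn)
  have h2 := hφ hmn
  simp only [Function.comp, ← hab] at h1 h2 ⊢
  rw [add_sub_cancel, add_sub_cancel]
  calc _ = a (φ n) + b (φ n) - (b (φ n) - k (φ n) • δ.1.order) := by abel
    _ ≤ a (φ m) + b (φ m) - (b (φ m) - k (φ m) • δ.1.order) := sub_le_sub h1 h2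
    _ = _ := by abel

/-- The terms of all Taylor series of a summable family form a summable family. The regularity of
`κ` bounds the union of the supports over all degrees. -/
theorem isSummable_taylorTerm (hκ : κ.IsRegular)
    (hder : IsStronglyLinear (der : Series Γ K κ →ₗ[K] Series Γ K κ))
    (htri : IsStronglyLinear tri.toLinearMap) (hτ : StrictMono (valueHom tri))
    (hdich : DerivativeDichotomy der x) (hx : x ≠ 0) (hδ : StrictlyDominated δ (tri x))
    {I : Type u} {s : I → Series Γ K κ} (hs : IsSummable s)
    (hsM : ∀ i, supp (s i) ⊆ taylorMonomials der tri δ) :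
    IsSummable fun p : I × ℕ => taylorTerm der tri δ (s p.1) p.2 := by
  obtain ⟨t, ht⟩ := hs.exists_hasFormalSum
  have hfix := fun k => (hasFormalSum_taylorTerm_apply (δ := δ) hder htri ht k).1
  have hbad := fun (i : ℕ → I) (k : ℕ → ℕ) (hk : StrictMono k) (w : ℕ → Δ) =>
    not_antitone_taylorTerm hder htri hτ hdich hx hδ hs hsM (i := i) (w := w) hk
  refine ⟨isPWO_of_forall_not_strictAnti fun w hw hanti => ?_, ?_, fun γ => ?_⟩
  · choose p hp using fun n => Set.mem_iUnion.1 (hw n)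
    obtain ⟨φ, hφ | hφ⟩ := exists_strictMono_or_const_subseq fun n => (p n).2
    · exact hbad (fun n => (p (φ n)).1) _ hφ (w ∘ φ) (fun n => hp (φ n))
        (hanti.antitone.comp_monotone φ.monotone)
    · refine not_strictAnti_of_mem_isPWO (hfix (p (φ 0)).2).isPWO (f := w ∘ φ) (fun n => ?_)
        (hanti.comp_strictMono φ.strictMono)
      have := hp (φ n)
      simp only [hφ n] at this
      exact Set.mem_iUnion.2 ⟨_, this⟩
  · have hsub : (⋃ p : I × ℕ, supp (taylorTerm der tri δ (s p.1) p.2)) ⊆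
        ⋃ k : ULift.{u} ℕ, ⋃ i, supp (taylorTerm der tri δ (s i) k.down) :=
      Set.iUnion_subset fun p γ hγ => Set.mem_iUnion.2 ⟨⟨p.2⟩, Set.mem_iUnion.2 ⟨p.1, hγ⟩⟩
    refine (mk_le_mk_of_subset hsub).trans_lt
      ((card_iUnion_lt_iff_forall_of_isRegular hκ ?_).2 fun k => (hfix k.down).card_lt)
    exact (mk_le_aleph0 (α := ULift.{u} ℕ)).trans_lt Fact.out
  · have hfin : {k | ∃ i, γ ∈ supp (taylorTerm der tri δ (s i) k)}.Finite := by
      by_contra hinf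
      choose i hi using fun n : ℕ => Nat.nth_mem_of_infinite hinf n
      exact hbad i _ (Nat.nth_strictMono hinf) (fun _ => γ) hi antitone_const
    refine (hfin.biUnion fun k _ => ((hfix k).finite γ).image fun i => (i, k)).subset
      fun p hp => ?_
    exact Set.mem_biUnion (x := p.2) ⟨p.1, hp⟩ ⟨p.1, hp, rfl⟩

/-- A Taylor series has the same leading term as its term of degree zero. -/
theorem coeff_eq_of_hasFormalSum_taylorTerm
    (hder : IsStronglyLinear (der : Series Γ K κ →ₗ[K] Series Γ K κ))
    (htri : IsStronglyLinear tri.toLinearMap) (hτ : StrictMono (valueHom tri))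
    (hdich : DerivativeDichotomy der x) (hx : x ≠ 0) (hδ : StrictlyDominated δ (tri x))
    {s : Series Γ K κ} (hs0 : s ≠ 0) (hs : supp s ⊆ taylorMonomials der tri δ) {t : Series Δ K κ}
    (ht : HasFormalSum (taylorTerm der tri δ s) t) {γ : Δ} (hγ : γ ≤ (tri s).1.order) :
    t.1.coeff γ = (tri s).1.coeff γ := by
  rw [ht.2, finsum_eq_single _ 0, taylorTerm_zero]
  intro k hk
  by_contra hne
  obtain ⟨a, ha, b, hb, rfl⟩ := exists_of_mem_supp_taylorTerm hne
  have hδ0 : δ ≠ 0 := by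
    rintro rfl
    rw [zero_pow hk, supp_zero] at hb
    exact hb
  obtain ⟨q, hq, h⟩ := Set.mem_iUnion₂.1 (htri.supp_subset _ ha)
  have h1 := (valueHom_le_reach htri hτ hdich hx hδ hδ0 hs
    (fun m hm => order_le_of_mem_supp hm) (supp_iterate_der_subset hder subset_rfl k hq)).2 hk
  have h2 : k • δ.1.order ≤ b := by
    have := order_le_of_mem_supp hb
    rwa [show (δ ^ k).1.order = k • δ.1.order from order_pow δ.1 k] at this
  rw [order_map htri hτ hs0] at hγ
  exact not_lt.2 hγ (h1.trans_le (add_le_add (valueHom_le_of_mem_supp h) h2))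

theorem mem_supportedIn {G : AddSubgroup Γ} {s : Series Γ K κ} :
    s ∈ supportedIn K κ G ↔ supp s ⊆ G := Iff.rfl

theorem coe_supportedIn (G : AddSubgroup Γ) :
    (supportedIn K κ G : Set (Series Γ K κ)) = {s | supp s ⊆ G} := rfl

theorem isSummable_const {I : Type*} [Finite I] [Nonempty I] (s : Series Γ K κ) :
    IsSummable fun _ : I => s := by
  have h : (⋃ _ : I, supp s) = supp s := Set.iUnion_const _
  refine ⟨?_, ?_, fun _ => Set.toFinite _⟩
  · rw [h]
    exact supp_isPWO s
  · rw [h]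
    exact card_supp_lt s

/-- The Taylor morphism on the field of series with supports in the Taylor domain. -/
theorem exists_taylorHom [LinearOrder K] [IsStrictOrderedRing K] (hκ : κ.IsRegular)
    (hder : IsStronglyLinear (der : Series Γ K κ →ₗ[K] Series Γ K κ))
    (htri : IsStronglyLinear tri.toLinearMap)
    (htri_lt : ∀ s t : Series Γ K κ, Less s t → Less (tri s) (tri t))
    (hdich : DerivativeDichotomy der x) (hx : x ≠ 0) (hδ : StrictlyDominated δ (tri x))
    {F : IntermediateField K (Series Γ K κ)}
    (hFM : ∀ s : F, supp (s : Series Γ K κ) ⊆ taylorMonomials der tri δ) :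
    ∃ T : F →ₐ[K] Series Δ K κ,
      (∀ s : F, HasFormalSum (taylorTerm der tri δ (s : Series Γ K κ)) (T s)) ∧
      IsStronglyLinearFrom F T.toLinearMap ∧
      ∀ s t : F, Less (s : Series Γ K κ) (t : Series Γ K κ) → Less (T s) (T t) := by
  have hτ := valueHom_strictMono htri_lt
  have hsum : ∀ {I : Type u} (s : I → F), IsSummable (fun i => (s i : Series Γ K κ)) →
      IsSummable fun p : I × ℕ => taylorTerm der tri δ (s p.1 : Series Γ K κ) p.2 := fun s hs =>
    isSummable_taylorTerm (s := fun i => (s i : Series Γ K κ)) hκ hder htri hτ hdich hx hδ hs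
      fun i => hFM (s i)
  have hex : ∀ s : F, ∃ t, HasFormalSum (taylorTerm der tri δ (s : Series Γ K κ)) t := by
    intro s
    have h2 := (hsum (fun _ : PUnit.{u + 1} => s) (isSummable_const _)).comp_injective
      (f := fun k : ℕ => (PUnit.unit, k)) fun a b h => (Prod.mk.inj h).2
    exact IsSummable.exists_hasFormalSum h2
  choose T hT using hex
  have hT1 : T 1 = 1 := by
    refine (hT 1).unique ⟨(hT 1).1, fun γ => ?_⟩
    rw [finsum_eq_single _ 0]
    · change _ = (taylorTerm der tri δ (1 : Series Γ K κ) 0).1.coeff γ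
      rw [taylorTerm_zero, map_one]
    · intro k hk
      obtain ⟨k, rfl⟩ := Nat.exists_eq_succ_of_ne_zero hk
      change (taylorTerm der tri δ (1 : Series Γ K κ) (k + 1)).1.coeff γ = 0
      rw [taylorTerm_one_succ]
      rfl
  have hTmul : ∀ s t, T (s * t) = T s * T t := fun s t =>
    ((hT s).mul (hT t)).antidiagonal (hT (s * t)) fun n => taylorTerm_mul _ _ n
  let Tlin : F →ₗ[K] Series Δ K κ :=
    { toFun := T
      map_add' := fun s t => by
        have h := (hT s).add (hT t)
        simp only [← taylorTerm_add] at h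
        exact (hT (s + t)).unique h
      map_smul' := fun c s => by
        have h := (hT s).const_smul c
        simp only [← taylorTerm_smul] at h
        exact (hT (c • s)).unique h }
  refine ⟨AlgHom.ofLinearMap Tlin hT1 hTmul, hT, fun I s t hst => ?_, fun s t hst => ?_⟩
  · obtain ⟨c, hc⟩ := (hsum s hst.1).exists_hasFormalSum
    have h1 := hc.of_prod fun i => hT (s i)
    -- Summation in the other order identifies the double sum.
    have h2 := (hc.comp_equiv (Equiv.prodComm ℕ I)).of_prod fun k =>
      hasFormalSum_taylorTerm_apply hder htri hst k
    rwa [h2.unique (hT t)] at h1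
  · have hu : ((t - s : F) : Series Γ K κ) ≠ 0 := by
      intro h0
      have h1 : (t : Series Γ K κ) - s = 0 := h0
      unfold Less at hst
      rw [h1] at hst
      exact lt_irrefl (0 : K) (lt_of_lt_of_eq hst leadingCoeff_zero)
    have h1 : Less 0 (tri (t - s : Series Γ K κ)) := by
      have := htri_lt 0 (t - s : Series Γ K κ) (by
        unfold Less
        rw [sub_zero]
        exact hst)
      rwa [map_zero] at this
    have h2 := leadingCoeff_eq_of_forall_le (coe_ne_zero ((map_ne_zero tri).2 hu))
      fun γ hγ => coeff_eq_of_hasFormalSum_taylorTerm hder htri hτ hdich hx hδ hu (hFM (t - s))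
        (hT (t - s)) hγ
    unfold Less at h1 ⊢
    rw [sub_zero] at h1
    change 0 < (Tlin t - Tlin s).1.leadingCoeff
    rw [← map_sub]
    exact lt_of_lt_of_eq h1 h2.symm

end

end HahnTaylor

end

theorem mainTheorem3 {K : Type v} [Field K] [LinearOrder K] [IsStrictOrderedRing K]
    {Γ Δ : Type u}
    [AddCommGroup Γ] [LinearOrder Γ] [IsOrderedAddMonoid Γ] [Nontrivial Γ]
    [AddCommGroup Δ] [LinearOrder Δ] [IsOrderedAddMonoid Δ] [Nontrivial Δ]
    (κ : Cardinal.{u}) [Fact (ℵ₀ < κ)] (hκ : κ.IsRegular)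
    (l : Γ →+ Series Γ K κ) (der : Derivation K (Series Γ K κ) (Series Γ K κ))
    (hS : IsDifferentialPreLogarithmic l der)
    (tri : Series Γ K κ →ₐ[K] Series Δ K κ)
    (htri : IsStronglyLinear tri.toLinearMap)
    (htri_lt : ∀ s t : Series Γ K κ, Less s t → Less (tri s) (tri t))
    (x : Series Γ K κ) (hx : x ≠ 0) (hdich : DerivativeDichotomy der x)
    (δ : Series Δ K κ) (hδ : StrictlyDominated δ (tri x)) :
    (∃ G : AddSubgroup Γ, (G : Set Γ) = taylorMonomials der tri δ) ∧
    ∃ F : IntermediateField K (Series Γ K κ),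
      (F : Set (Series Γ K κ)) = taylorSeries der tri δ ∧
      (∀ s ∈ F, der s ∈ F) ∧
      ∃ T : F →ₐ[K] Series Δ K κ,
        (∀ s : F, HasFormalSum (taylorTerm der tri δ (s : Series Γ K κ)) (T s)) ∧
        IsStronglyLinearFrom F T.toLinearMap ∧
        ∀ s t : F, Less (s : Series Γ K κ) (t : Series Γ K κ) → Less (T s) (T t) := by
  have hder := hS.stronglyLinear
  have hτ := valueHom_strictMono htri_lt
  refine ⟨⟨taylorSubgroup der tri δ, rfl⟩, supportedIn K κ (taylorSubgroup der tri δ),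
    coe_supportedIn _, fun s hs => ?_, exists_taylorHom hκ hder htri htri_lt hdich hx hδ
      fun s => mem_supportedIn.1 s.2⟩
  rw [mem_supportedIn] at hs ⊢
  refine (hder.supp_subset s).trans (Set.iUnion₂_subset fun γ hγ η hη => ?_)
  have := add_mem_taylorMonomials htri hτ hdich hx hδ (hs hγ)
    (add_mem_supp_der.1 ((add_sub_cancel γ η).symm ▸ hη))
  rwa [add_sub_cancel] at this
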